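/- **Proposition (limiting kernels of time-evolved mean-field rotators).** Let $S^1\subset\mathbb R^2$ be the unit circle with equidistribution $\alpha$, let $\beta\ge 0$, $t\ge 0$ and $h\in\mathbb R^2$. For $N\ge 1$ and $\sigma=(\sigma_1,\dots,\sigma_N)\in (S^1)^N$ put $m(\sigma)=\frac1N\sum_{i=1}^N\sigma_i\in\mathbb R^2$, and let $$\mu_{\beta,h,N}(d\sigma)=\frac1{Z_{\beta,h,N}}\exp\Bigl(\tfrac{N\beta}{2}|m(\sigma)|^2+N\beta\, h\cdot m(\sigma)\Bigr)\prod_{i=1}^N\alpha(d\sigma_i)$$ be the quadratic mean-field rotator model. Let $p_t(\sigma,d\eta)$ be the transition kernel of Brownian motion on the circle with generator $d^2/d\theta^2$ (so $p_0(\sigma,\cdot)=\delta_\sigma$, and for $t>0$ the density in the angle difference $\theta$ is $\frac1{2\pi}+\frac1\pi\sum_{k\ge1}e^{-k^2t}\cos(k\theta)$), and let $$\mu_{\beta,h,t,N}(d\eta)=\int\mu_{\beta,h,N}(d\sigma)\prod_{i=1}^N p_t(\sigma_i,d\eta_i).$$ (a) For every $N\ge1$ the conditional distribution of $\eta_1$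 given $(\eta_2,\dots,\eta_N)$ under $\mu_{\beta,h,t,N}$ has exactly one version $\mu_{\beta,h,t,N}(d\eta_1\mid x_2,\dots,x_N)$ that is weakly continuous in $(x_2,\dots,x_N)\in(S^1)^{N-1}$. (b) For a Borel probability measure $\lambda$ on $S^1$ and $m\in\mathbb R^2$ let $$F(m;\beta,h,t,\lambda)=\beta\frac{|m|^2}{2}-\int\lambda(d\eta)\log\int e^{\beta\,\sigma\cdot(m+h)}\,p_t(\eta,d\sigma).$$ If $m\mapsto F(m;\beta,h,t,\lambda)$ has a unique minimizer $m^*=m^*(\beta,h,t,\lambda)$ in the closed unit disk, then the limiting kernel of the evolved model at $\lambda$ exists and is $$\gamma'_{1,\beta,h,t}(d\eta_1\mid\lambda)=\frac{\int e^{\beta\,\sigma_1\cdot(m^*+h)}\,p_t(\sigma_1,d\eta_1)\,\alpha(d\sigma_1)}{\int e^{\beta\,\sigma_1\cdot(m^*+h)}\,\alpha(d\sigma_1)}.$$ That is, for all conditionings $x^N=(x^N_2,\dots,x^N_N)\in (S^1)^{N-1}$, $N\ge 1$, such that $\frac1N\sum_{i=2}^N\delta_{x_i^N}\to\lambda$ weakly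 as $N\to\infty$, the measures $\mu_{\beta,h,t,N}(d\eta_1\mid x^N)$, taken in the version of (a), converge to $\gamma'_{1,\beta,h,t}(d\eta_1\mid\lambda)$, both weakly and on every Borel subset of $S^1$. -/

import Mathlib

open MeasureTheory ProbabilityTheory Filter Topology
open scoped NNReal ENNReal

namespace MeanFieldRotator

/-! The spins live on the unit circle `Circle ⊆ ℂ`, with `ℂ` as the Euclidean plane and
`inner ℝ z w` as its scalar product. -/

noncomputable instance instMeasurableSpaceCircle : MeasurableSpace Circle := borel Circle

instance instBorelSpaceCircle : BorelSpace Circle := ⟨rfl⟩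

noncomputable section

/-- The equidistribution `α` on the circle: the image of the normalized Lebesgue measure on
`(-π, π]` under `θ ↦ e^{iθ}`. -/
def unif : Measure Circle :=
  (ENNReal.ofReal (2 * Real.pi))⁻¹ •
    (volume.restrict (Set.Ioc (-Real.pi) Real.pi)).map (fun θ : ℝ => Circle.exp θ)

instance unif_isProbabilityMeasure : IsProbabilityMeasure unif := by
  refine ⟨?_⟩
  have hm : Measurable (fun θ : ℝ => Circle.exp θ) := Circle.exp.continuous.measurable
  have hpos : (0 : ℝ) < 2 * Real.pi := by positivity
  rw [unif, Measure.smul_apply, Measure.map_apply hm MeasurableSet.univ, Set.preimage_univ,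
    Measure.restrict_apply_univ, Real.volume_Ioc, smul_eq_mul,
    show Real.pi - -Real.pi = 2 * Real.pi by ring]
  exact ENNReal.inv_mul_cancel (by simpa using hpos) ENNReal.ofReal_ne_top

/-- The transition kernel `p_t(σ, dη)` of Brownian motion on the circle (with generator the
Laplacian `d²/dθ²`): the law of `σ e^{i √2 B_t}` for a standard Brownian motion `B` on the line,
so that its density in angular coordinates is
`q_t(θ) = 1/(2π) + (1/π) ∑_{k ≥ 1} e^{-k² t} cos (k θ)` for `t > 0`, and `p_0(σ, ·) = δ_σ`. -/
def heatKernel (t : ℝ≥0) : Kernel Circle Circle where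
  toFun σ := (gaussianReal 0 (2 * t)).map (fun θ => σ * Circle.exp θ)
  measurable' := by
    have hg : Measurable (fun p : Circle × ℝ => p.1 * Circle.exp p.2) :=
      (continuous_fst.mul (Circle.exp.continuous.comp continuous_snd)).measurable
    have h := (Measure.measurable_map _ hg).comp
      (Measurable.map_prodMk_left (ν := gaussianReal 0 (2 * t)) (α := Circle))
    convert h using 1
    funext σ
    exact (Measure.map_map hg measurable_prodMk_left).symm

instance heatKernel_isMarkovKernel (t : ℝ≥0) : IsMarkovKernel (heatKernel t) := by
  refine ⟨fun σ => ?_⟩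
  have hg : Measurable (fun θ : ℝ => σ * Circle.exp θ) :=
    (continuous_const.mul Circle.exp.continuous).measurable
  exact Measure.isProbabilityMeasure_map hg.aemeasurable

/-- Independent Brownian motions at all sites: the kernel `∏ᵢ p_t(σᵢ, dηᵢ)`. -/
def productHeatKernel (t : ℝ≥0) (N : ℕ) : Kernel (Fin N → Circle) (Fin N → Circle) where
  toFun σ := Measure.pi (fun i => heatKernel t (σ i))
  measurable' := by
    have hg : Measurable
        (fun p : (Fin N → Circle) × (Fin N → ℝ) => fun i => p.1 i * Circle.exp (p.2 i)) := by
      refine Continuous.measurable ?_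
      refine continuous_pi fun i => ?_
      exact ((continuous_apply i).comp continuous_fst).mul
        (Circle.exp.continuous.comp ((continuous_apply i).comp continuous_snd))
    have h := (Measure.measurable_map _ hg).comp
      (Measurable.map_prodMk_left (ν := Measure.pi fun _ : Fin N => gaussianReal 0 (2 * t))
        (α := Fin N → Circle))
    convert h using 1
    funext σ
    have h1 := Measure.map_map (μ := Measure.pi fun _ : Fin N => gaussianReal 0 (2 * t))
      hg (measurable_prodMk_left (x := σ))
    have hi : ∀ i, AEMeasurable (fun θ : ℝ => σ i * Circle.exp θ) (gaussianReal 0 (2 * t)) :=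
      fun i => (continuous_const.mul Circle.exp.continuous).measurable.aemeasurable
    have : ∀ i, SigmaFinite
        ((gaussianReal 0 (2 * t)).map (fun θ : ℝ => σ i * Circle.exp θ)) := fun i =>
      inferInstanceAs (SigmaFinite (heatKernel t (σ i)))
    have h2 := Measure.pi_map_pi (μ := fun _ : Fin N => gaussianReal 0 (2 * t)) hi
    exact (h1.trans h2).symm

/-- The magnetization `m(σ₁, …, σ_N) = (1/N) ∑ᵢ σᵢ`, a vector in the plane. -/
def magnetization {N : ℕ} (σ : Fin N → Circle) : ℂ :=
  (N : ℝ)⁻¹ • ∑ i, (σ i : ℂ)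

/-- The unnormalized Gibbs density `exp (N β |m|² / 2 + N β h · m)`. -/
def gibbsWeight (β : ℝ) (h : ℂ) {N : ℕ} (σ : Fin N → Circle) : ℝ≥0∞ :=
  ENNReal.ofReal (Real.exp
    (N * β * ‖magnetization σ‖ ^ 2 / 2 + N * β * inner ℝ h (magnetization σ)))

/-- The quadratic mean-field rotator model `μ_{β,h,N}` on `Circle^N`. -/
def gibbsMeasure (β : ℝ) (h : ℂ) (N : ℕ) : Measure (Fin N → Circle) :=
  (∫⁻ σ, gibbsWeight β h σ ∂(Measure.pi fun _ : Fin N => unif))⁻¹ •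
    (Measure.pi fun _ : Fin N => unif).withDensity (gibbsWeight β h)

/-- The time-evolved model
`μ_{β,h,t,N}(dη) = ∫ μ_{β,h,N}(dσ) ∏ᵢ p_t(σᵢ, dηᵢ)`. -/
def evolvedMeasure (β : ℝ) (h : ℂ) (t : ℝ≥0) (N : ℕ) : Measure (Fin N → Circle) :=
  (gibbsMeasure β h N).bind (productHeatKernel t N)

/-- `κ` is a weakly continuous version of the conditional distribution, under `μ`, of the spin
at the first site given the spins at all other sites. -/
def IsContinuousConditional {N : ℕ} (μ : Measure (Fin (N + 1) → Circle))
    (κ : (Fin N → Circle) → ProbabilityMeasure Circle) : Prop :=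
  Continuous κ ∧
    ∀ (A : Set Circle) (B : Set (Fin N → Circle)), MeasurableSet A → MeasurableSet B →
      μ {η | η 0 ∈ A ∧ Fin.tail η ∈ B} =
        ∫⁻ η in {η | Fin.tail η ∈ B}, (κ (Fin.tail η) : Measure Circle) A ∂μ

/-- The empirical distribution `(1/(N+1)) ∑ᵢ δ_{xᵢ}` of the `N` conditioning spins in the volume of
size `N + 1` (a measure of total mass `N/(N+1)`). -/
def conditioningEmpirical {N : ℕ} (x : Fin N → Circle) : FiniteMeasure Circle :=
  ((N : ℝ≥0) + 1)⁻¹ • ∑ i, (diracProba (x i)).toFiniteMeasure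

/-- The constrained rate function
`F(m; β,h,t,λ) = β |m|² / 2 - ∫ λ(dη) log ∫ e^{β σ · (m + h)} p_t(η, dσ)`. -/
def rateFunction (β : ℝ) (h : ℂ) (t : ℝ≥0) (lam : ProbabilityMeasure Circle) (m : ℂ) : ℝ :=
  β * ‖m‖ ^ 2 / 2 -
    ∫ η, Real.log (∫ σ, Real.exp (β * inner ℝ (σ : ℂ) (m + h)) ∂(heatKernel t η))
      ∂(lam : Measure Circle)

/-- `m` is the unique minimizer of `F(·; β,h,t,λ)` in the closed unit disk. -/
def IsUniqueMinimizer (β : ℝ) (h : ℂ) (t : ℝ≥0) (lam : ProbabilityMeasure Circle) (m : ℂ) : Prop :=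
  m ∈ Metric.closedBall (0 : ℂ) 1 ∧
    ∀ m' ∈ Metric.closedBall (0 : ℂ) 1, m' ≠ m →
      rateFunction β h t lam m < rateFunction β h t lam m'

/-- The tilting density `σ ↦ e^{β σ · (m + h)}`. -/
def tilt (β : ℝ) (h m : ℂ) (σ : Circle) : ℝ≥0∞ :=
  ENNReal.ofReal (Real.exp (β * inner ℝ (σ : ℂ) (m + h)))

/-- The measure
`∫ e^{β σ · (m + h)} p_t(σ, dη) α(dσ) / ∫ e^{β σ · (m + h)} α(dσ)`. -/
def tiltedMeasure (β : ℝ) (h : ℂ) (t : ℝ≥0) (m : ℂ) : Measure Circle :=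
  (∫⁻ σ, tilt β h m σ ∂unif)⁻¹ • (unif.withDensity (tilt β h m)).bind (heatKernel t)

theorem continuous_tilt (β : ℝ) (h m : ℂ) : Continuous (tilt β h m) := by
  exact ENNReal.continuous_ofReal.comp (by fun_prop)

instance tiltedMeasure_isProbabilityMeasure (β : ℝ) (h : ℂ) (t : ℝ≥0) (m : ℂ) :
    IsProbabilityMeasure (tiltedMeasure β h t m) := by
  refine ⟨?_⟩
  have hne : (∫⁻ σ, tilt β h m σ ∂unif) ≠ 0 := by
    intro h0
    rw [lintegral_eq_zero_iff (continuous_tilt β h m).measurable] at h0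
    obtain ⟨σ, hσ⟩ := h0.exists
    simp only [tilt, Pi.zero_apply, ENNReal.ofReal_eq_zero] at hσ
    exact absurd hσ (not_le.mpr (Real.exp_pos _))
  have hfin : (∫⁻ σ, tilt β h m σ ∂unif) ≠ ∞ := by
    obtain ⟨C, hC⟩ := (isCompact_range (show Continuous fun σ : Circle =>
      Real.exp (β * inner ℝ (σ : ℂ) (m + h)) by fun_prop)).bddAbove
    refine ne_top_of_le_ne_top (ENNReal.ofReal_ne_top (r := C)) ?_
    calc (∫⁻ σ, tilt β h m σ ∂unif) ≤ ∫⁻ _, ENNReal.ofReal C ∂unif :=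
          lintegral_mono fun σ => ENNReal.ofReal_le_ofReal (hC ⟨σ, rfl⟩)
      _ = ENNReal.ofReal C := by simp
  rw [tiltedMeasure, Measure.smul_apply,
    Measure.bind_apply MeasurableSet.univ (heatKernel t).measurable.aemeasurable]
  simp only [measure_univ, lintegral_one, withDensity_apply _ MeasurableSet.univ,
    Measure.restrict_univ, smul_eq_mul]
  exact ENNReal.inv_mul_cancel hne hfin

/-- The limiting kernel, as a probability measure. -/
def limitKernel (β : ℝ) (h : ℂ) (t : ℝ≥0) (m : ℂ) : ProbabilityMeasure Circle :=
  ⟨tiltedMeasure β h t m, inferInstance⟩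

end

end MeanFieldRotator

/-!
The heat kernel on the circle is a symmetric convolution, hence reversible for the equidistribution
`α`, at every time `t ≥ 0` including `t = 0`. The evolved model therefore has the density
`D(η) = ∫ exp (N β |m(σ)|² / 2 + N β h · m(σ)) ∏ᵢ p_t(ηᵢ, dσᵢ)` with respect to `α^N`, up to a
constant (`evolvedMeasure_eq_withDensity`), and `D` is continuous and strictly positive. Normalizing
`D` in the first coordinate gives a weakly continuous conditional distribution. Another continuous
version agrees with it almost everywhere for a law that charges all open sets, hence everywhere
(`IsContinuousConditional.eq_of_density`).

For the limit, completing the square turns the quadratic interaction into a Gaussian mixture of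
independent spins (the Hubbard-Stratonovich transformation), and with
`φ(a, m) = ∫ e^{β σ · (m + h)} p_t(a, dσ)` the density of the first spin given `x` becomes
proportional to `a ↦ ∫ φ(a, m) e^{-(N+1) F_N(m)} dm`, an integral over the plane
(`gaussianMass_mul_evolvedDensity`). Here `F_N` is the rate function with `λ` replaced by the
empirical distribution of `x`. The functions `log φ(a, ·)` are `β`-Lipschitz uniformly in `a`, so
`F_N → F` uniformly on compact sets; they also give a quadratic lower bound for all `F_N`, and show
that the minimizer `m*` in the unit disk is the unique minimizer in the plane. By Laplace's method
(`tendsto_laplace_zero`) the probability measures `∝ e^{-(N+1) F_N(m)} dm` concentrate at `m*`.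
Applied to a function that dominates `|φ(a, m) - φ(a, m*)|` for all `a` at once, this shows that the
densities converge uniformly in `a`, so that the conditional probabilities of every Borel set
converge, and weak convergence follows by the portmanteau theorem. The limiting density
`a ↦ φ(a, m*)` is that of the tilted measure, again by reversibility.
-/

open MeasureTheory ProbabilityTheory Filter Topology
open scoped NNReal ENNReal

namespace MeanFieldRotator

noncomputable section

/-! ### The equidistribution is the Haar measure of the circle -/

theorem integral_unif (f : Circle → ℝ) (hf : Continuous f) :
    ∫ σ, f σ ∂unif = (2 * Real.pi)⁻¹ * ∫ θ in -Real.pi..Real.pi, f (Circle.exp θ) := by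
  have hpos : (0 : ℝ) < 2 * Real.pi := by positivity
  rw [unif, integral_smul_measure, integral_map Circle.exp.continuous.measurable.aemeasurable
    hf.aestronglyMeasurable, intervalIntegral.integral_of_le (by linarith [Real.pi_pos])]
  rw [ENNReal.toReal_inv, ENNReal.toReal_ofReal hpos.le, smul_eq_mul]

instance unif_isMulLeftInvariant : unif.IsMulLeftInvariant := by
  refine ⟨fun g => ?_⟩
  obtain ⟨a, rfl⟩ := Circle.exp_surjective g
  have hm : Measurable (fun x : Circle => Circle.exp a * x) :=
    (continuous_const.mul continuous_id).measurable
  have : IsProbabilityMeasure (unif.map (fun x : Circle => Circle.exp a * x)) :=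
    Measure.isProbabilityMeasure_map hm.aemeasurable
  refine ext_of_forall_integral_eq_of_IsFiniteMeasure fun f => ?_
  rw [integral_map hm.aemeasurable f.continuous.aestronglyMeasurable, integral_unif _ (by fun_prop),
    integral_unif _ f.continuous]
  congr 1
  have hper : Function.Periodic (fun θ : ℝ => f (Circle.exp θ)) (2 * Real.pi) := fun θ => by
    simp [Circle.exp_add, Circle.exp_two_pi]
  simp_rw [← Circle.exp_add]
  rw [intervalIntegral.integral_comp_add_left (fun θ : ℝ => f (Circle.exp θ)) a]
  have := hper.intervalIntegral_add_eq (a + -Real.pi) (-Real.pi)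
  rw [show a + -Real.pi + 2 * Real.pi = a + Real.pi by ring,
    show -Real.pi + 2 * Real.pi = Real.pi by ring] at this
  exact this

instance unif_isOpenPosMeasure : unif.IsOpenPosMeasure :=
  isOpenPosMeasure_of_mulLeftInvariant_of_compact Set.univ isCompact_univ (by simp)

/-! ### Reversibility of the heat kernel -/

/-- The law of the increment `e^{i √2 B_t}` of circular Brownian motion. -/
def heatIncrement (t : ℝ≥0) : Measure Circle :=
  (gaussianReal 0 (2 * t)).map (fun θ => Circle.exp θ)

instance heatIncrement_isProbabilityMeasure (t : ℝ≥0) : IsProbabilityMeasure (heatIncrement t) :=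
  Measure.isProbabilityMeasure_map Circle.exp.continuous.measurable.aemeasurable

instance heatIncrement_isInvInvariant (t : ℝ≥0) : (heatIncrement t).IsInvInvariant := by
  refine ⟨?_⟩
  have he : Measurable (fun θ : ℝ => Circle.exp θ) := Circle.exp.continuous.measurable
  rw [Measure.inv, heatIncrement, Measure.map_map measurable_inv he]
  conv_rhs => rw [← neg_zero, ← gaussianReal_map_neg, Measure.map_map he measurable_neg]
  congr 1
  funext θ
  simp [Circle.exp_neg]

theorem heatKernel_eq_map (t : ℝ≥0) (σ : Circle) :
    heatKernel t σ = (heatIncrement t).map (fun u => σ * u) := by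
  rw [heatIncrement, Measure.map_map (measurable_const_mul σ) Circle.exp.continuous.measurable]
  rfl

theorem productHeatKernel_eq_map (t : ℝ≥0) (N : ℕ) (σ : Fin N → Circle) :
    productHeatKernel t N σ = (Measure.pi fun _ => heatIncrement t).map (fun u => σ * u) := by
  have h : ∀ i, AEMeasurable (fun u : Circle => σ i * u) (heatIncrement t) :=
    fun i => (measurable_const_mul (σ i)).aemeasurable
  have : ∀ i, SigmaFinite ((heatIncrement t).map (fun u : Circle => σ i * u)) := fun i => by
    rw [← heatKernel_eq_map]; infer_instance
  have h2 := Measure.pi_map_pi (μ := fun _ : Fin N => heatIncrement t) h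
  change Measure.pi (fun i => heatKernel t (σ i)) = _
  simp_rw [heatKernel_eq_map]
  exact h2.symm

instance productHeatKernel_isMarkovKernel (t : ℝ≥0) (N : ℕ) :
    IsMarkovKernel (productHeatKernel t N) :=
  ⟨fun σ => inferInstanceAs (IsProbabilityMeasure (Measure.pi fun i => heatKernel t (σ i)))⟩

/-- A random walk on a commutative group whose step law is symmetric is reversible with respect to
every invariant measure: substitute `σ ↦ σ u⁻¹`, then `u ↦ u⁻¹`. -/
theorem lintegral_translate_symm {G : Type*} [CommGroup G] [MeasurableSpace G] [MeasurableMul₂ G]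
    [MeasurableInv G] (μ γ : Measure G) [SFinite μ] [SFinite γ] [μ.IsMulLeftInvariant]
    [γ.IsInvInvariant] {f g : G → ℝ≥0∞} (hf : Measurable f) (hg : Measurable g) :
    ∫⁻ σ, f σ * ∫⁻ u, g (σ * u) ∂γ ∂μ = ∫⁻ σ, g σ * ∫⁻ u, f (σ * u) ∂γ ∂μ := by
  have hmul : Measurable (fun p : G × G => p.1 * p.2) := measurable_mul
  have swap : ∀ f g : G → ℝ≥0∞, Measurable f → Measurable g →
      ∫⁻ σ, f σ * ∫⁻ u, g (σ * u) ∂γ ∂μ = ∫⁻ u, ∫⁻ σ, f σ * g (σ * u) ∂μ ∂γ := by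
    intro f g hf hg
    have h1 : ∀ σ, f σ * ∫⁻ u, g (σ * u) ∂γ = ∫⁻ u, f σ * g (σ * u) ∂γ := fun σ =>
      (lintegral_const_mul _ (hg.comp (measurable_const_mul σ))).symm
    simp_rw [h1]
    exact lintegral_lintegral_swap
      ((hf.comp measurable_fst).mul (hg.comp hmul)).aemeasurable
  rw [swap f g hf hg, swap g f hg hf, ← lintegral_inv_eq_self (μ := γ)]
  refine lintegral_congr fun u => ?_
  rw [← lintegral_mul_left_eq_self _ u]
  refine lintegral_congr fun σ => ?_
  rw [mul_comm u σ, mul_inv_cancel_right, mul_comm]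

theorem lintegral_heatKernel_symm (t : ℝ≥0) {f g : Circle → ℝ≥0∞} (hf : Measurable f)
    (hg : Measurable g) :
    ∫⁻ σ, f σ * ∫⁻ η, g η ∂(heatKernel t σ) ∂unif =
      ∫⁻ η, g η * ∫⁻ σ, f σ ∂(heatKernel t η) ∂unif := by
  have h : ∀ (k : Circle → ℝ≥0∞), Measurable k → ∀ σ,
      ∫⁻ η, k η ∂(heatKernel t σ) = ∫⁻ u, k (σ * u) ∂(heatIncrement t) := fun k hk σ => by
    rw [heatKernel_eq_map, lintegral_map hk (measurable_const_mul σ)]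
  simp_rw [h f hf, h g hg]
  exact lintegral_translate_symm _ _ hf hg

theorem lintegral_productHeatKernel_symm (t : ℝ≥0) (N : ℕ) {f g : (Fin N → Circle) → ℝ≥0∞}
    (hf : Measurable f) (hg : Measurable g) :
    ∫⁻ σ, f σ * ∫⁻ η, g η ∂(productHeatKernel t N σ) ∂(Measure.pi fun _ => unif) =
      ∫⁻ η, g η * ∫⁻ σ, f σ ∂(productHeatKernel t N η) ∂(Measure.pi fun _ => unif) := by
  have h : ∀ (k : (Fin N → Circle) → ℝ≥0∞), Measurable k → ∀ σ,
      ∫⁻ η, k η ∂(productHeatKernel t N σ) =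
        ∫⁻ u, k (σ * u) ∂(Measure.pi fun _ => heatIncrement t) := fun k hk σ => by
    rw [productHeatKernel_eq_map, lintegral_map hk (measurable_const_mul σ)]
  simp_rw [h f hf, h g hg]
  exact lintegral_translate_symm _ _ hf hg

/-! ### Kernels acting on continuous functions -/

/-- Averages of translates of a continuous function on a compact group are continuous. -/
theorem continuous_integral_translate {G : Type*} [Group G] [TopologicalSpace G] [ContinuousMul G]
    [CompactSpace G] [FirstCountableTopology G] [MeasurableSpace G] [OpensMeasurableSpace G]
    [SecondCountableTopology G]
    (γ : Measure G) [IsFiniteMeasure γ] {f : G → ℝ} (hf : Continuous f) :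
    Continuous fun σ => ∫ u, f (σ * u) ∂γ := by
  obtain ⟨C, hC⟩ := isCompact_univ.exists_bound_of_continuousOn hf.continuousOn
  refine continuous_of_dominated (bound := fun _ => C) (fun σ => ?_) (fun σ => ?_)
    (integrable_const C) ?_
  · exact (hf.comp (continuous_const.mul continuous_id)).aestronglyMeasurable
  · exact Eventually.of_forall fun u => hC _ (Set.mem_univ _)
  · exact Eventually.of_forall fun u => hf.comp (continuous_id.mul continuous_const)

theorem continuous_integral_heatKernel (t : ℝ≥0) {f : Circle → ℝ} (hf : Continuous f) :
    Continuous fun η => ∫ σ, f σ ∂(heatKernel t η) := by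
  have h : ∀ η, ∫ σ, f σ ∂(heatKernel t η) = ∫ u, f (η * u) ∂(heatIncrement t) := fun η => by
    rw [heatKernel_eq_map, integral_map (measurable_const_mul η).aemeasurable
      hf.aestronglyMeasurable]
  simp_rw [h]
  exact continuous_integral_translate _ hf

theorem continuous_integral_productHeatKernel (t : ℝ≥0) (N : ℕ) {f : (Fin N → Circle) → ℝ}
    (hf : Continuous f) : Continuous fun η => ∫ σ, f σ ∂(productHeatKernel t N η) := by
  have h : ∀ η, ∫ σ, f σ ∂(productHeatKernel t N η) =
      ∫ u, f (η * u) ∂(Measure.pi fun _ => heatIncrement t) := fun η => by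
    rw [productHeatKernel_eq_map, integral_map (measurable_const_mul η).aemeasurable
      hf.aestronglyMeasurable]
  simp_rw [h]
  exact continuous_integral_translate _ hf

theorem integrable_of_continuous_compact {X : Type*} [TopologicalSpace X] [CompactSpace X]
    [MeasurableSpace X] [OpensMeasurableSpace X] {μ : Measure X} [IsFiniteMeasure μ]
    {f : X → ℝ} (hf : Continuous f) : Integrable f μ := by
  obtain ⟨C, hC⟩ := isCompact_univ.exists_bound_of_continuousOn hf.continuousOn
  exact Integrable.of_bound hf.measurable.aestronglyMeasurable C
    (Eventually.of_forall fun u => hC _ (Set.mem_univ _))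

/-! ### The density of the evolved model -/

/-- The unnormalized Gibbs density as a real number. -/
def gibbsFactor (β : ℝ) (h : ℂ) {N : ℕ} (σ : Fin N → Circle) : ℝ :=
  Real.exp (N * β * ‖magnetization σ‖ ^ 2 / 2 + N * β * inner ℝ h (magnetization σ))

theorem continuous_gibbsFactor (β : ℝ) (h : ℂ) (N : ℕ) :
    Continuous (gibbsFactor β h : (Fin N → Circle) → ℝ) := by
  unfold gibbsFactor magnetization
  fun_prop

/-- The unnormalized density of the evolved model with respect to the product of
equidistributions; by reversibility it is the heat flow applied to the Gibbs density. -/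
def evolvedDensity (β : ℝ) (h : ℂ) (t : ℝ≥0) {N : ℕ} (η : Fin N → Circle) : ℝ :=
  ∫ σ, gibbsFactor β h σ ∂(productHeatKernel t N η)

theorem continuous_evolvedDensity (β : ℝ) (h : ℂ) (t : ℝ≥0) (N : ℕ) :
    Continuous (evolvedDensity β h t : (Fin N → Circle) → ℝ) :=
  continuous_integral_productHeatKernel t N (continuous_gibbsFactor β h N)

theorem evolvedDensity_pos (β : ℝ) (h : ℂ) (t : ℝ≥0) {N : ℕ} (η : Fin N → Circle) :
    0 < evolvedDensity β h t η :=
  integral_exp_pos (integrable_of_continuous_compact (continuous_gibbsFactor β h N))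

theorem evolvedMeasure_eq_withDensity (β : ℝ) (h : ℂ) (t : ℝ≥0) (N : ℕ) :
    evolvedMeasure β h t N = (∫⁻ σ, gibbsWeight β h σ ∂(Measure.pi fun _ : Fin N => unif))⁻¹ •
      (Measure.pi fun _ : Fin N => unif).withDensity
        (fun η => ENNReal.ofReal (evolvedDensity β h t η)) := by
  have hw : Measurable (gibbsWeight β h : (Fin N → Circle) → ℝ≥0∞) :=
    (continuous_gibbsFactor β h N).measurable.ennreal_ofReal
  ext A hA
  rw [evolvedMeasure, Measure.bind_apply hA (productHeatKernel t N).measurable.aemeasurable,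
    gibbsMeasure, lintegral_smul_measure, Measure.smul_apply, withDensity_apply _ hA,
    lintegral_withDensity_eq_lintegral_mul _ hw ((productHeatKernel t N).measurable_coe hA)]
  congr 1
  have h1 := lintegral_productHeatKernel_symm t N hw (measurable_one.indicator hA)
  simp only [lintegral_indicator_one hA] at h1
  refine Eq.trans h1 ?_
  rw [← lintegral_indicator hA]
  have hD : ∀ η, ENNReal.ofReal (evolvedDensity β h t η) =
      ∫⁻ σ, gibbsWeight β h σ ∂(productHeatKernel t N η) := fun η =>
    ofReal_integral_eq_lintegral_ofReal
      (integrable_of_continuous_compact (continuous_gibbsFactor β h N))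
      (Eventually.of_forall fun σ => (Real.exp_pos _).le)
  refine lintegral_congr fun η => ?_
  by_cases hη : η ∈ A <;> simp [hη, hD]

theorem lintegral_gibbsWeight_ne_zero (β : ℝ) (h : ℂ) (N : ℕ) :
    ∫⁻ σ, gibbsWeight β h σ ∂(Measure.pi fun _ : Fin N => unif) ≠ 0 := by
  have hw : Measurable (gibbsWeight β h : (Fin N → Circle) → ℝ≥0∞) :=
    (continuous_gibbsFactor β h N).measurable.ennreal_ofReal
  intro h0
  rw [lintegral_eq_zero_iff hw] at h0
  obtain ⟨σ, hσ⟩ := h0.exists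
  simp only [gibbsWeight, Pi.zero_apply, ENNReal.ofReal_eq_zero] at hσ
  exact absurd hσ (not_le.mpr (Real.exp_pos _))

theorem lintegral_gibbsWeight_ne_top (β : ℝ) (h : ℂ) (N : ℕ) :
    ∫⁻ σ, gibbsWeight β h σ ∂(Measure.pi fun _ : Fin N => unif) ≠ ∞ :=
  (integrable_of_continuous_compact (continuous_gibbsFactor β h N)).lintegral_lt_top.ne

/-! ### Conditional distributions from a continuous positive density -/

/-- The conditional distribution of the first spin given that the others are `x`, for a law with
density `D` with respect to the product of equidistributions. -/
def conditionalMeasure {N : ℕ} (D : (Fin (N + 1) → Circle) → ℝ) (x : Fin N → Circle) :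
    Measure Circle :=
  unif.withDensity fun a =>
    ENNReal.ofReal (D (Fin.cons a x) / ∫ b, D (Fin.cons b x) ∂unif)

section Density

variable {N : ℕ} {D : (Fin (N + 1) → Circle) → ℝ}

theorem continuous_cons : Continuous fun p : (Fin N → Circle) × Circle =>
    (Fin.cons p.2 p.1 : Fin (N + 1) → Circle) :=
  Continuous.finCons (A := fun _ => Circle) continuous_snd continuous_fst

theorem continuous_cons_left (x : Fin N → Circle) :
    Continuous fun a : Circle => (Fin.cons a x : Fin (N + 1) → Circle) :=
  continuous_cons.comp (continuous_const.prodMk continuous_id)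

theorem continuous_integral_cons_mul (hD : Continuous D) {f : Circle → ℝ} (hf : Continuous f) :
    Continuous fun x : Fin N → Circle => ∫ a, D (Fin.cons a x) * f a ∂unif := by
  have := continuous_parametric_integral_of_continuous (μ := unif)
    (f := fun (x : Fin N → Circle) (a : Circle) => D (Fin.cons a x) * f a)
    ((hD.comp continuous_cons).mul (hf.comp continuous_snd)) isCompact_univ
  simpa using this

theorem integrable_cons (hD : Continuous D) (x : Fin N → Circle) :
    Integrable (fun a => D (Fin.cons a x)) unif :=
  integrable_of_continuous_compact (hD.comp (continuous_cons_left x))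

theorem integral_cons_pos (hD : Continuous D) (hpos : ∀ η, 0 < D η) (x : Fin N → Circle) :
    0 < ∫ b, D (Fin.cons b x) ∂unif := by
  rw [integral_pos_iff_support_of_nonneg (fun a => (hpos _).le) (integrable_cons hD x)]
  have : (Function.support fun a => D (Fin.cons a x : Fin (N + 1) → Circle)) = Set.univ :=
    Set.eq_univ_of_forall fun a => (hpos _).ne'
  simp [this]

theorem conditionalMeasure_apply (hD : Continuous D) (hpos : ∀ η, 0 < D η) (x : Fin N → Circle)
    {A : Set Circle} (hA : MeasurableSet A) :
    conditionalMeasure D x A = ENNReal.ofReal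
      ((∫ a in A, D (Fin.cons a x) ∂unif) / ∫ b, D (Fin.cons b x) ∂unif) := by
  rw [conditionalMeasure, withDensity_apply _ hA, ← integral_div,
    ofReal_integral_eq_lintegral_ofReal ((integrable_cons hD x).div_const _).integrableOn]
  exact Eventually.of_forall fun a => div_nonneg (hpos _).le (integral_cons_pos hD hpos x).le

theorem isProbabilityMeasure_conditionalMeasure (hD : Continuous D) (hpos : ∀ η, 0 < D η)
    (x : Fin N → Circle) : IsProbabilityMeasure (conditionalMeasure D x) := by
  refine ⟨?_⟩
  rw [conditionalMeasure_apply hD hpos x MeasurableSet.univ, Measure.restrict_univ,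
    div_self (integral_cons_pos hD hpos x).ne', ENNReal.ofReal_one]

/-- `conditionalMeasure` as a family of probability measures. -/
def conditionalKernel (hD : Continuous D) (hpos : ∀ η, 0 < D η) (x : Fin N → Circle) :
    ProbabilityMeasure Circle :=
  ⟨conditionalMeasure D x, isProbabilityMeasure_conditionalMeasure hD hpos x⟩

theorem continuous_conditionalKernel (hD : Continuous D) (hpos : ∀ η, 0 < D η) :
    Continuous (conditionalKernel hD hpos) := by
  rw [continuous_iff_continuousAt]
  intro x
  refine ProbabilityMeasure.tendsto_iff_forall_integral_tendsto.mpr fun f => ?_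
  have heq : ∀ y : Fin N → Circle, ∫ a, f a ∂(conditionalKernel hD hpos y : Measure Circle) =
      (∫ a, D (Fin.cons a y) * f a ∂unif) / ∫ a, D (Fin.cons a y) * 1 ∂unif := by
    intro y
    change ∫ a, f a ∂(conditionalMeasure D y) = _
    rw [conditionalMeasure, integral_withDensity_eq_integral_toReal_smul, ← integral_div]
    · refine integral_congr_ae (Eventually.of_forall fun a => ?_)
      simp only [mul_one]
      rw [ENNReal.toReal_ofReal (div_nonneg (hpos _).le (integral_cons_pos hD hpos y).le),
        smul_eq_mul, div_mul_eq_mul_div]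
    · exact (((hD.comp (continuous_cons_left y)).div_const _).measurable).ennreal_ofReal
    · exact Eventually.of_forall fun a => ENNReal.ofReal_lt_top
  simp_rw [heq]
  refine ((continuous_integral_cons_mul hD f.continuous).tendsto x).div
    ((continuous_integral_cons_mul hD continuous_const).tendsto x) ?_
  simpa using (integral_cons_pos hD hpos x).ne'

theorem lintegral_pi_succ {f : (Fin (N + 1) → Circle) → ℝ≥0∞} (hf : Measurable f) :
    ∫⁻ η, f η ∂(Measure.pi fun _ => unif) =
      ∫⁻ x, ∫⁻ a, f (Fin.cons a x) ∂unif ∂(Measure.pi fun _ : Fin N => unif) := by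
  have h := (measurePreserving_piFinSuccAbove (fun _ : Fin (N + 1) => unif) 0).symm
  rw [← h.lintegral_comp hf, lintegral_prod_symm']
  · simp [MeasurableEquiv.piFinSuccAbove_symm_apply, Fin.insertNthEquiv]
  · exact hf.comp h.measurable

theorem measurable_tail : Measurable (Fin.tail : (Fin (N + 1) → Circle) → Fin N → Circle) :=
  measurable_pi_lambda _ fun i => measurable_pi_apply i.succ

/-- Under the law with density `D`, the spins other than the first have density
`x ↦ ∫ D (b, x) α(db)`. -/
theorem lintegral_withDensity_tail (hD : Continuous D) (hpos : ∀ η, 0 < D η)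
    {g : (Fin N → Circle) → ℝ≥0∞} (hg : Measurable g) :
    ∫⁻ η, g (Fin.tail η) ∂((Measure.pi fun _ => unif).withDensity fun η =>
        ENNReal.ofReal (D η)) =
      ∫⁻ x, ENNReal.ofReal (∫ b, D (Fin.cons b x) ∂unif) * g x
        ∂(Measure.pi fun _ : Fin N => unif) := by
  have hDm : Measurable fun η => ENNReal.ofReal (D η) := hD.measurable.ennreal_ofReal
  have hgt : Measurable fun η : Fin (N + 1) → Circle => g (Fin.tail η) := hg.comp measurable_tail
  rw [lintegral_withDensity_eq_lintegral_mul _ hDm hgt,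
    lintegral_pi_succ (hDm.mul hgt)]
  refine lintegral_congr fun x => ?_
  have hDx : Measurable fun a => ENNReal.ofReal (D (Fin.cons a x)) :=
    hDm.comp (continuous_cons_left x).measurable
  simp only [Pi.mul_apply, Fin.tail_cons]
  rw [lintegral_mul_const _ hDx,
    ofReal_integral_eq_lintegral_ofReal (integrable_cons hD x)
      (Eventually.of_forall fun a => (hpos _).le)]

/-- A weakly continuous family of probability measures is a kernel. -/
theorem measurable_coe_of_continuous {X : Type*} [TopologicalSpace X] [MeasurableSpace X]
    [OpensMeasurableSpace X] {κ : X → ProbabilityMeasure Circle} (hκ : Continuous κ) :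
    Measurable fun x => (κ x : Measure Circle) := by
  refine Measurable.measure_of_isPiSystem_of_isProbabilityMeasure
    (BorelSpace.measurable_eq.trans borel_eq_generateFrom_isClosed) isPiSystem_isClosed ?_
  intro F hF
  -- The indicator of a closed set is a pointwise limit of continuous functions.
  have hδ : ∀ n : ℕ, (0 : ℝ) < 1 / ((n : ℝ) + 1) := fun n => Nat.one_div_pos_of_nat
  have hlim := fun x => tendsto_lintegral_thickenedIndicator_of_isClosed
    (κ x : Measure Circle) hF hδ tendsto_one_div_add_atTop_nhds_zero_nat
  refine measurable_of_tendsto_metrizable (fun n => ?_) (tendsto_pi_nhds.mpr hlim)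
  exact ((ProbabilityMeasure.continuous_lintegral_boundedContinuousFunction _).comp hκ).measurable

theorem isContinuousConditional_conditionalKernel (hD : Continuous D) (hpos : ∀ η, 0 < D η)
    (c : ℝ≥0∞) :
    IsContinuousConditional (c • (Measure.pi fun _ => unif).withDensity fun η =>
      ENNReal.ofReal (D η)) (conditionalKernel hD hpos) := by
  refine ⟨continuous_conditionalKernel hD hpos, fun A B hA hB => ?_⟩
  have hDm : Measurable fun η => ENNReal.ofReal (D η) := hD.measurable.ennreal_ofReal
  have hB' : MeasurableSet {η : Fin (N + 1) → Circle | Fin.tail η ∈ B} := measurable_tail hB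
  have hA' : MeasurableSet {η : Fin (N + 1) → Circle | η 0 ∈ A ∧ Fin.tail η ∈ B} :=
    (measurable_pi_apply 0 hA).inter hB'
  have hκ : Measurable fun x => (conditionalKernel hD hpos x : Measure Circle) A :=
    (Measure.measurable_coe hA).comp
      (measurable_coe_of_continuous (continuous_conditionalKernel hD hpos))
  rw [Measure.restrict_smul, lintegral_smul_measure, Measure.smul_apply]
  congr 1
  rw [← lintegral_indicator hB']
  have h1 := lintegral_withDensity_tail hD hpos (hκ.indicator hB)
  refine Eq.trans ?_ (Eq.trans h1.symm (lintegral_congr fun η => ?_))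
  · rw [withDensity_apply _ hA', ← lintegral_indicator hA', lintegral_pi_succ (hDm.indicator hA')]
    refine lintegral_congr fun x => ?_
    by_cases hx : x ∈ B
    · rw [Set.indicator_of_mem hx]
      change _ = _ * conditionalMeasure D x A
      rw [conditionalMeasure_apply hD hpos x hA,
        ← ENNReal.ofReal_mul (integral_cons_pos hD hpos x).le,
        mul_div_cancel₀ _ (integral_cons_pos hD hpos x).ne',
        ofReal_integral_eq_lintegral_ofReal (integrable_cons hD x).integrableOn
          (Eventually.of_forall fun a => (hpos _).le), ← lintegral_indicator hA]
      refine lintegral_congr fun a => ?_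
      by_cases ha : a ∈ A <;> simp [Set.indicator, ha, hx]
    · simp [Set.indicator, hx]
  · by_cases hη : Fin.tail η ∈ B <;> simp [Set.indicator, hη]

/-- Continuous versions are unique: any two agree almost everywhere with respect to the law of the
other spins, and that law charges every nonempty open set. -/
theorem IsContinuousConditional.eq_of_density (hD : Continuous D) (hpos : ∀ η, 0 < D η)
    {c : ℝ≥0∞} (hc : c ≠ 0) (hc' : c ≠ ∞) {κ κ' : (Fin N → Circle) → ProbabilityMeasure Circle}
    (hκ : IsContinuousConditional (c • (Measure.pi fun _ => unif).withDensity fun η =>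
      ENNReal.ofReal (D η)) κ)
    (hκ' : IsContinuousConditional (c • (Measure.pi fun _ => unif).withDensity fun η =>
      ENNReal.ofReal (D η)) κ') : κ' = κ := by
  set μ : Measure (Fin (N + 1) → Circle) := c • (Measure.pi fun _ => unif).withDensity fun η =>
      ENNReal.ofReal (D η) with hμ
  set ν := μ.map Fin.tail with hν
  have hDm : Measurable fun η => ENNReal.ofReal (D η) := hD.measurable.ennreal_ofReal
  have hfin : IsFiniteMeasure μ := by
    refine ⟨?_⟩
    rw [hμ, Measure.smul_apply, withDensity_apply _ MeasurableSet.univ, Measure.restrict_univ]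
    exact ENNReal.mul_lt_top hc'.lt_top (integrable_of_continuous_compact hD).lintegral_lt_top
  have hopen : (Measure.pi fun _ : Fin N => unif) ≪ ν := by
    refine Measure.AbsolutelyContinuous.mk fun B hB h0 => ?_
    rw [hν, Measure.map_apply measurable_tail hB, hμ, Measure.smul_apply, smul_eq_mul,
      mul_eq_zero_iff_left hc] at h0
    have h1 := lintegral_withDensity_tail hD hpos (measurable_one.indicator hB)
    have h2 : ∀ η : Fin (N + 1) → Circle, B.indicator (1 : (Fin N → Circle) → ℝ≥0∞) (Fin.tail η) =
        (Fin.tail ⁻¹' B).indicator 1 η := fun η => rfl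
    simp_rw [h2] at h1
    rw [lintegral_indicator_one (measurable_tail hB), h0] at h1
    have hm : Measurable fun x : Fin N → Circle => ENNReal.ofReal (∫ b, D (Fin.cons b x) ∂unif) := by
      simpa using (continuous_integral_cons_mul hD
        (continuous_const (y := (1 : ℝ)))).measurable.ennreal_ofReal
    have h3 := (lintegral_eq_zero_iff (hm.mul (measurable_one.indicator hB))).mp h1.symm
    have h4 : ∀ᵐ x ∂(Measure.pi fun _ : Fin N => unif), x ∉ B := by
      filter_upwards [h3] with x hx hxB
      simp [hxB, not_le.mpr (integral_cons_pos hD hpos x)] at hx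
    simpa [ae_iff] using h4
  let K : ∀ κ : (Fin N → Circle) → ProbabilityMeasure Circle, Continuous κ →
      Kernel (Fin N → Circle) Circle := fun κ h => ⟨fun x => κ x, measurable_coe_of_continuous h⟩
  have hmark : ∀ κ h, IsMarkovKernel (K κ h) := fun κ h => ⟨fun x => (κ x).2⟩
  have hcomp : ∀ κ (h : IsContinuousConditional μ κ),
      ν ⊗ₘ (K κ h.1) = μ.map (fun η => (Fin.tail η, η 0)) := by
    intro κ h
    have hpair : Measurable fun η : Fin (N + 1) → Circle => (Fin.tail η, η 0) :=
      measurable_tail.prodMk (measurable_pi_apply 0)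
    have := hmark κ h.1
    refine Measure.ext_prod fun {B A} hB hA => ?_
    rw [Measure.compProd_apply_prod hB hA, Measure.map_apply hpair (hB.prod hA), hν,
      setLIntegral_map hB ((K κ h.1).measurable_coe hA) measurable_tail]
    refine Eq.trans (h.2 A B hA hB).symm (congrArg μ ?_)
    ext η
    simp [and_comm]
  have hae : ∀ᵐ x ∂ν, K κ' hκ'.1 x = K κ hκ.1 x := by
    have := hmark κ hκ.1
    have := hmark κ' hκ'.1
    exact Kernel.ae_eq_of_compProd_eq ((hcomp κ' hκ').trans (hcomp κ hκ).symm)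
  refine Measure.eq_of_ae_eq (μ := Measure.pi fun _ : Fin N => unif) ?_ hκ'.1 hκ.1
  filter_upwards [hopen.ae_le hae] with x hx
  exact Subtype.ext hx

end Density

/-! ### The single-site weight -/

/-- The single-site Laplace transform `∫ e^{β σ · (m + h)} p_t(η, dσ)`. -/
def siteWeight (β : ℝ) (h : ℂ) (t : ℝ≥0) (m : ℂ) (η : Circle) : ℝ :=
  ∫ σ, Real.exp (β * inner ℝ (σ : ℂ) (m + h)) ∂(heatKernel t η)

theorem continuous_exp_inner (β : ℝ) (z : ℂ) :
    Continuous fun σ : Circle => Real.exp (β * inner ℝ (σ : ℂ) z) := by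
  fun_prop

theorem abs_inner_circle_le (σ : Circle) (z : ℂ) : |inner ℝ (σ : ℂ) z| ≤ ‖z‖ :=
  (abs_real_inner_le_norm (σ : ℂ) z).trans_eq (by rw [Circle.norm_coe, one_mul])

theorem continuous_siteWeight (β : ℝ) (h : ℂ) (t : ℝ≥0) (m : ℂ) :
    Continuous (siteWeight β h t m) :=
  continuous_integral_heatKernel t (continuous_exp_inner β (m + h))

theorem siteWeight_pos (β : ℝ) (h : ℂ) (t : ℝ≥0) (m : ℂ) (η : Circle) :
    0 < siteWeight β h t m η :=
  integral_exp_pos (integrable_of_continuous_compact (continuous_exp_inner β (m + h)))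

theorem siteWeight_le_exp_mul {β : ℝ} (hβ : 0 ≤ β) (h : ℂ) (t : ℝ≥0) (m m' : ℂ) (η : Circle) :
    siteWeight β h t m η ≤ Real.exp (β * ‖m - m'‖) * siteWeight β h t m' η := by
  unfold siteWeight
  rw [← integral_const_mul]
  refine integral_mono (integrable_of_continuous_compact (continuous_exp_inner β (m + h)))
    ((integrable_of_continuous_compact (continuous_exp_inner β (m' + h))).const_mul _) fun σ => ?_
  simp only
  rw [← Real.exp_add, Real.exp_le_exp, ← mul_add]
  refine mul_le_mul_of_nonneg_left ?_ hβ
  have h1 := (le_abs_self _).trans (abs_inner_circle_le σ (m - m'))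
  have h2 : inner ℝ (σ : ℂ) (m + h) = inner ℝ (σ : ℂ) (m - m') + inner ℝ (σ : ℂ) (m' + h) := by
    rw [← inner_add_right]; congr 1; ring
  linarith

theorem abs_log_siteWeight_sub_le {β : ℝ} (hβ : 0 ≤ β) (h : ℂ) (t : ℝ≥0) (m m' : ℂ) (η : Circle) :
    |Real.log (siteWeight β h t m η) - Real.log (siteWeight β h t m' η)| ≤ β * ‖m - m'‖ := by
  have key : ∀ a b : ℂ, Real.log (siteWeight β h t a η) ≤
      β * ‖a - b‖ + Real.log (siteWeight β h t b η) := fun a b => by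
    have := Real.log_le_log (siteWeight_pos β h t a η) (siteWeight_le_exp_mul hβ h t a b η)
    rwa [Real.log_mul (Real.exp_pos _).ne' (siteWeight_pos β h t b η).ne', Real.log_exp] at this
  have h1 := key m m'
  have h2 := key m' m
  rw [norm_sub_rev] at h2
  exact abs_le.mpr ⟨by linarith, by linarith⟩

theorem abs_log_siteWeight_le {β : ℝ} (hβ : 0 ≤ β) (h : ℂ) (t : ℝ≥0) (m : ℂ) (η : Circle) :
    |Real.log (siteWeight β h t m η)| ≤ β * (‖m‖ + ‖h‖) := by
  have h1 := abs_log_siteWeight_sub_le hβ h t m (-h) η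
  have h2 : siteWeight β h t (-h) η = 1 := by simp [siteWeight]
  rw [h2, Real.log_one, sub_zero, sub_neg_eq_add] at h1
  exact h1.trans (mul_le_mul_of_nonneg_left (norm_add_le _ _) hβ)

theorem siteWeight_le {β : ℝ} (hβ : 0 ≤ β) (h : ℂ) (t : ℝ≥0) (m : ℂ) (η : Circle) :
    siteWeight β h t m η ≤ Real.exp (β * (‖m‖ + ‖h‖)) := by
  rw [← Real.log_le_iff_le_exp (siteWeight_pos β h t m η)]
  exact (le_abs_self _).trans (abs_log_siteWeight_le hβ h t m η)

theorem continuous_log_siteWeight_left {β : ℝ} (hβ : 0 ≤ β) (h : ℂ) (t : ℝ≥0) (η : Circle) :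
    Continuous fun m => Real.log (siteWeight β h t m η) := by
  refine (LipschitzWith.of_dist_le_mul (K := ⟨β, hβ⟩) fun m m' => ?_).continuous
  rw [Real.dist_eq, dist_eq_norm]
  exact abs_log_siteWeight_sub_le hβ h t m m' η

/-- A modulus of continuity of the single-site weight at `m'`, uniform in the site. -/
theorem abs_siteWeight_sub_le {β : ℝ} (hβ : 0 ≤ β) (h : ℂ) (t : ℝ≥0) (m m' : ℂ) (η : Circle) :
    |siteWeight β h t m η - siteWeight β h t m' η| ≤
      Real.exp (β * (‖m'‖ + ‖h‖)) * (Real.exp (β * ‖m - m'‖) - 1) := by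
  set d := β * ‖m - m'‖ with hd
  have hd0 : 0 ≤ d := by positivity
  have h1 := siteWeight_le_exp_mul hβ h t m m' η
  have h2 := siteWeight_le_exp_mul hβ h t m' m η
  rw [norm_sub_rev, ← hd] at h2
  rw [← hd] at h1
  have h3 := siteWeight_le hβ h t m' η
  have hp := siteWeight_pos β h t m η
  have hp' := siteWeight_pos β h t m' η
  have he : 1 ≤ Real.exp d := Real.one_le_exp hd0
  have h4 : siteWeight β h t m' η * (Real.exp d - 1) ≤
      Real.exp (β * (‖m'‖ + ‖h‖)) * (Real.exp d - 1) :=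
    mul_le_mul_of_nonneg_right h3 (by linarith)
  refine abs_le.mpr ⟨?_, by linarith⟩
  -- If `φ(m) ≤ φ(m')`, the bound `φ(m') ≤ e^d φ(m)` gives `φ(m') - φ(m) ≤ (e^d - 1) φ(m')`.
  rcases le_total (siteWeight β h t m η) (siteWeight β h t m' η) with hle | hle
  · have := mul_le_mul_of_nonneg_right hle (sub_nonneg.mpr he)
    linarith
  · have := mul_nonneg hp'.le (sub_nonneg.mpr he)
    linarith

/-! ### Linearization of the quadratic interaction -/

theorem continuous_norm_sq_add_exp (a b : ℝ) :
    Continuous fun m : ℂ => Real.exp (-a * ‖m‖ ^ 2 + b * ‖m‖) := by fun_prop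

theorem integrable_exp_neg_mul_sq_norm {a : ℝ} (ha : 0 < a) :
    Integrable fun m : ℂ => Real.exp (-a * ‖m‖ ^ 2) := by
  have := (GaussianFourier.integrable_cexp_neg_mul_sq_norm_add (V := ℂ) (b := (a : ℂ))
    (by simpa using ha) 0 0).norm
  simpa [Complex.norm_exp, ← Complex.ofReal_pow] using this

theorem integrable_exp_neg_mul_sq_norm_add {a : ℝ} (ha : 0 < a) (b : ℝ) :
    Integrable fun m : ℂ => Real.exp (-a * ‖m‖ ^ 2 + b * ‖m‖) := by
  refine ((integrable_exp_neg_mul_sq_norm (half_pos ha)).const_mul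
    (Real.exp (b ^ 2 / (2 * a)))).mono' (continuous_norm_sq_add_exp a b).aestronglyMeasurable
    (Eventually.of_forall fun m => ?_)
  rw [Real.norm_of_nonneg (Real.exp_pos _).le, ← Real.exp_add, Real.exp_le_exp]
  -- `b r ≤ b² / (2a) + a r² / 2`
  have h1 : b ^ 2 / (2 * a) + -(a / 2) * ‖m‖ ^ 2 - (-a * ‖m‖ ^ 2 + b * ‖m‖) =
      (b - a * ‖m‖) ^ 2 / (2 * a) := by
    field_simp
    ring
  have h2 : 0 ≤ (b - a * ‖m‖) ^ 2 / (2 * a) := by positivity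
  linarith

/-- The Gaussian normalization of the Hubbard-Stratonovich transformation. -/
def gaussianMass (β : ℝ) (n : ℕ) : ℝ := ∫ m : ℂ, Real.exp (-(n * β / 2) * ‖m‖ ^ 2)

theorem gaussianMass_pos {β : ℝ} (hβ : 0 < β) {n : ℕ} (hn : 0 < n) : 0 < gaussianMass β n :=
  integral_exp_pos (integrable_exp_neg_mul_sq_norm (by positivity))

/-- Completing the square: the exponential of the quadratic mean-field energy is a Gaussian mixture
of product weights. -/
theorem gaussianMass_mul_gibbsFactor (β : ℝ) (h : ℂ) {n : ℕ} (hn : 0 < n) (σ : Fin n → Circle) :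
    gaussianMass β n * gibbsFactor β h σ = ∫ m : ℂ, Real.exp (-(n * β / 2) * ‖m‖ ^ 2) *
      ∏ i, Real.exp (β * inner ℝ (σ i : ℂ) (m + h)) := by
  have hn' : (n : ℝ) ≠ 0 := by positivity
  have hsum : ∀ z : ℂ, ∑ i, β * inner ℝ (σ i : ℂ) z = n * β * inner ℝ (magnetization σ) z := by
    intro z
    rw [magnetization, real_inner_smul_left, sum_inner, ← Finset.mul_sum]
    field_simp
  have hsq : ∀ m : ℂ, Real.exp (-(n * β / 2) * ‖m‖ ^ 2) *
      ∏ i, Real.exp (β * inner ℝ (σ i : ℂ) (m + h)) =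
      Real.exp (-(n * β / 2) * ‖m - magnetization σ‖ ^ 2) * gibbsFactor β h σ := by
    intro m
    rw [← Real.exp_sum, hsum, gibbsFactor, ← Real.exp_add, ← Real.exp_add,
      norm_sub_sq_real, inner_add_right, real_inner_comm m, real_inner_comm h]
    congr 1
    ring
  simp_rw [hsq]
  rw [integral_mul_const, gaussianMass,
    integral_sub_right_eq_self fun m : ℂ => Real.exp (-(n * β / 2) * ‖m‖ ^ 2)]

theorem gaussianMass_mul_integral_gibbsFactor {β : ℝ} (hβ : 0 < β) (h : ℂ) {n : ℕ} (hn : 0 < n)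
    (p : Fin n → Measure Circle) [∀ i, IsProbabilityMeasure (p i)] :
    gaussianMass β n * ∫ σ, gibbsFactor β h σ ∂(Measure.pi p) =
      ∫ m : ℂ, Real.exp (-(n * β / 2) * ‖m‖ ^ 2) *
        ∏ i, ∫ σ, Real.exp (β * inner ℝ (σ : ℂ) (m + h)) ∂(p i) := by
  rw [← integral_const_mul]
  simp_rw [gaussianMass_mul_gibbsFactor β h hn]
  rw [integral_integral_swap]
  · refine integral_congr_ae (Eventually.of_forall fun m => ?_)
    simp only
    rw [integral_const_mul, integral_fintype_prod_eq_prod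
      (f := fun _ (σ : Circle) => Real.exp (β * inner ℝ (σ : ℂ) (m + h)))]
  · have hint := (integrable_exp_neg_mul_sq_norm_add (a := n * β / 2) (by positivity)
      (n * β)).const_mul (Real.exp (n * β * ‖h‖))
    refine (hint.comp_snd (Measure.pi p)).mono' ?_ (Eventually.of_forall fun q => ?_)
    · refine Continuous.aestronglyMeasurable ?_
      fun_prop
    · simp only [Function.uncurry]
      rw [← Real.exp_sum, ← Real.exp_add, ← Real.exp_add, Real.norm_of_nonneg (Real.exp_pos _).le,
        Real.exp_le_exp]
      have h1 : ∑ i, β * inner ℝ (q.1 i : ℂ) (q.2 + h) ≤ ∑ _i : Fin n, β * (‖q.2‖ + ‖h‖) :=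
        Finset.sum_le_sum fun i _ => mul_le_mul_of_nonneg_left
          ((le_abs_self _).trans ((abs_inner_circle_le _ _).trans (norm_add_le _ _))) hβ.le
      rw [Finset.sum_const, Finset.card_univ, Fintype.card_fin, nsmul_eq_mul] at h1
      linarith

/-- The rate function of the volume of size `N + 1` with conditioning `x`: the integral against `λ`
is replaced by the integral against the empirical distribution. -/
def empiricalRate (β : ℝ) (h : ℂ) (t : ℝ≥0) {N : ℕ} (x : Fin N → Circle) (m : ℂ) : ℝ :=
  β * ‖m‖ ^ 2 / 2 - ((N : ℝ) + 1)⁻¹ * ∑ i, Real.log (siteWeight β h t m (x i))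

/-- The evolved density as a Laplace integral over the plane. -/
theorem gaussianMass_mul_evolvedDensity {β : ℝ} (hβ : 0 < β) (h : ℂ) (t : ℝ≥0) {N : ℕ}
    (a : Circle) (x : Fin N → Circle) :
    gaussianMass β (N + 1) * evolvedDensity β h t (Fin.cons a x : Fin (N + 1) → Circle) =
      ∫ m : ℂ, siteWeight β h t m a *
        Real.exp (-((N : ℝ) + 1) * empiricalRate β h t x m) := by
  refine (gaussianMass_mul_integral_gibbsFactor hβ h N.succ_pos
    (fun i => heatKernel t ((Fin.cons a x : Fin (N + 1) → Circle) i))).trans ?_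
  refine integral_congr_ae (Eventually.of_forall fun m => ?_)
  have hN : (N : ℝ) + 1 ≠ 0 := by positivity
  simp only [Fin.prod_univ_succ, Fin.cons_zero, Fin.cons_succ]
  change _ * (siteWeight β h t m a * ∏ i, siteWeight β h t m (x i)) = _
  have h1 : ∏ i, siteWeight β h t m (x i) =
      Real.exp (∑ i, Real.log (siteWeight β h t m (x i))) := by
    rw [Real.exp_sum]
    exact Finset.prod_congr rfl fun i _ => (Real.exp_log (siteWeight_pos β h t m (x i))).symm
  rw [h1, mul_left_comm, ← Real.exp_add]
  congr 2
  rw [empiricalRate, mul_sub, neg_mul (_ + _) (_⁻¹ * _), mul_inv_cancel_left₀ hN]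
  push_cast
  ring

/-! ### Laplace's method -/

/-- Pointwise convergence of equi-Lipschitz functions is uniform on compact sets. -/
theorem eventually_forall_abs_sub_lt_of_lipschitz {X : Type*} [PseudoMetricSpace X] {K : ℝ}
    {f : ℕ → X → ℝ} {g : X → ℝ} (hf : ∀ n x y, |f n x - f n y| ≤ K * dist x y)
    (hlim : ∀ x, Tendsto (fun n => f n x) atTop (𝓝 (g x))) {S : Set X} (hS : IsCompact S)
    {ε : ℝ} (hε : 0 < ε) : ∀ᶠ n in atTop, ∀ x ∈ S, |f n x - g x| < ε := by
  have hg : ∀ x y, |g x - g y| ≤ K * dist x y := fun x y =>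
    le_of_tendsto ((hlim x).sub (hlim y)).abs (Eventually.of_forall fun n => hf n x y)
  have hK : 0 < |K| + 1 := by positivity
  set δ := ε / (3 * (|K| + 1)) with hδ
  have hδ0 : 0 < δ := by positivity
  obtain ⟨T, -, hTfin, hT⟩ := hS.finite_cover_balls hδ0
  have hev : ∀ᶠ n in atTop, ∀ y ∈ T, |f n y - g y| < ε / 3 :=
    hTfin.eventually_all.mpr fun y _ => by
      have := (Metric.tendsto_nhds.mp (hlim y)) (ε / 3) (by positivity)
      simpa only [Real.dist_eq] using this
  filter_upwards [hev] with n hn x hx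
  obtain ⟨y, hy, hxy⟩ := Set.mem_iUnion₂.mp (hT hx)
  have hsmall : K * dist x y ≤ ε / 3 := by
    have h1 : K * dist x y ≤ (|K| + 1) * δ :=
      mul_le_mul (by linarith [le_abs_self K]) (Metric.mem_ball.mp hxy).le dist_nonneg hK.le
    have h2 : (|K| + 1) * δ = ε / 3 := by rw [hδ]; field_simp
    linarith
  have h1 := abs_le.mp ((hf n x y).trans hsmall)
  have h2 := abs_le.mp ((hg x y).trans hsmall)
  have h3 := abs_lt.mp (hn y hy)
  exact abs_lt.mpr ⟨by linarith, by linarith⟩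

/-- The probability measures proportional to `e^{-(n+1) F_n}` concentrate at `m₀`, if `F_n` is
asymptotically at most `F₀` near `m₀` and uniformly larger than `F₀` away from `m₀`. -/
theorem tendsto_laplace_zero {E : Type*} [PseudoMetricSpace E] [ProperSpace E] [MeasurableSpace E]
    [OpensMeasurableSpace E] {μ : Measure E} [IsFiniteMeasureOnCompacts μ] [μ.IsOpenPosMeasure]
    {F : ℕ → E → ℝ} {F₀ : ℝ} {m₀ : E} {g B : E → ℝ} (hg : ContinuousAt g m₀) (hg0 : g m₀ = 0)
    (hgnn : ∀ m, 0 ≤ g m)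
    (hnear : ∀ ε > 0, ∃ δ > 0, ∀ᶠ n in atTop, ∀ m ∈ Metric.ball m₀ δ, F n m ≤ F₀ + ε)
    (hfar : ∀ δ > 0, ∃ c > 0, ∀ᶠ n in atTop, ∀ m ∉ Metric.ball m₀ δ, F₀ + c ≤ F n m)
    (hB : Integrable B μ) (hBle : ∀ n m, g m * Real.exp (-F n m) ≤ B m)
    (hint : ∀ n : ℕ, Integrable (fun m => Real.exp (-((n : ℝ) + 1) * F n m)) μ)
    (hintg : ∀ n : ℕ, Integrable (fun m => g m * Real.exp (-((n : ℝ) + 1) * F n m)) μ) :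
    Tendsto (fun n : ℕ => (∫ m, g m * Real.exp (-((n : ℝ) + 1) * F n m) ∂μ) /
      ∫ m, Real.exp (-((n : ℝ) + 1) * F n m) ∂μ) atTop (𝓝 0) := by
  have hB0 : ∀ m, 0 ≤ B m := fun m =>
    (mul_nonneg (hgnn m) (Real.exp_pos _).le).trans (hBle 0 m)
  have hI0 : 0 ≤ ∫ m, B m ∂μ := integral_nonneg hB0
  rw [Metric.tendsto_nhds]
  intro ε hε
  obtain ⟨δ, hδ, hgδ⟩ := Metric.continuousAt_iff.mp hg (ε / 2) (half_pos hε)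
  obtain ⟨c, hc, hfar'⟩ := hfar δ hδ
  obtain ⟨δ', hδ', hnear'⟩ := hnear (c / 2) (half_pos hc)
  set v := μ.real (Metric.ball m₀ δ') with hv
  have hv0 : 0 < v :=
    ENNReal.toReal_pos (Metric.measure_ball_pos μ m₀ hδ').ne' measure_ball_lt_top.ne
  have hq : Tendsto (fun n : ℕ => (∫ m, B m ∂μ) / v * Real.exp (F₀ + c / 2) *
      Real.exp (-(c / 2)) ^ n) atTop (𝓝 0) := by
    have := (tendsto_pow_atTop_nhds_zero_of_lt_one (Real.exp_pos _).le
      (Real.exp_lt_one_iff.mpr (show -(c / 2) < 0 by linarith))).const_mul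
        ((∫ m, B m ∂μ) / v * Real.exp (F₀ + c / 2))
    rwa [mul_zero] at this
  filter_upwards [hfar', hnear', hq.eventually_lt_const (half_pos hε)] with n hn1 hn2 hn3
  set Z := ∫ m, Real.exp (-((n : ℝ) + 1) * F n m) ∂μ with hZ
  have hn0 : (0 : ℝ) ≤ n := n.cast_nonneg
  have hZlow : v * Real.exp (-((n : ℝ) + 1) * (F₀ + c / 2)) ≤ Z := by
    calc v * Real.exp (-((n : ℝ) + 1) * (F₀ + c / 2))
        = ∫ m in Metric.ball m₀ δ', Real.exp (-((n : ℝ) + 1) * (F₀ + c / 2)) ∂μ := by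
          rw [setIntegral_const, smul_eq_mul]
      _ ≤ ∫ m in Metric.ball m₀ δ', Real.exp (-((n : ℝ) + 1) * F n m) ∂μ := by
          refine setIntegral_mono_on (integrableOn_const measure_ball_lt_top.ne)
            (hint n).integrableOn Metric.isOpen_ball.measurableSet fun m hm => ?_
          rw [Real.exp_le_exp]
          have := mul_le_mul_of_nonneg_left (hn2 m hm) (show (0 : ℝ) ≤ n + 1 by linarith)
          linarith
      _ ≤ Z := setIntegral_le_integral (hint n)
          (Eventually.of_forall fun m => (Real.exp_pos _).le)
  have hZ0 : 0 < Z := lt_of_lt_of_le (by positivity) hZlow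
  have hnum : ∫ m, g m * Real.exp (-((n : ℝ) + 1) * F n m) ∂μ ≤
      ε / 2 * Z + Real.exp (-n * (F₀ + c)) * ∫ m, B m ∂μ := by
    rw [hZ, ← integral_const_mul, ← integral_const_mul,
      ← integral_add ((hint n).const_mul _) (hB.const_mul _)]
    refine integral_mono (hintg n) (((hint n).const_mul _).add (hB.const_mul _)) fun m => ?_
    simp only
    by_cases hm : m ∈ Metric.ball m₀ δ
    · have h1 := hgδ hm
      rw [hg0, dist_zero_right, Real.norm_of_nonneg (hgnn m)] at h1
      have h2 := mul_le_mul_of_nonneg_right h1.le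
        (Real.exp_pos (-((n : ℝ) + 1) * F n m)).le
      have h3 := mul_nonneg (Real.exp_pos (-n * (F₀ + c))).le (hB0 m)
      linarith
    · -- Away from `m₀`, all but one of the `n + 1` factors are bounded by `e^{-(F₀ + c)}`.
      have h1 : Real.exp (-((n : ℝ) + 1) * F n m) =
          Real.exp (-n * F n m) * Real.exp (-F n m) := by
        rw [← Real.exp_add]; congr 1; ring
      have h2 : Real.exp (-n * F n m) ≤ Real.exp (-n * (F₀ + c)) := by
        rw [Real.exp_le_exp]
        have := mul_le_mul_of_nonneg_left (hn1 m hm) hn0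
        linarith
      have h3 := mul_le_mul h2 (hBle n m) (mul_nonneg (hgnn m) (Real.exp_pos _).le)
        (Real.exp_pos _).le
      have h4 : 0 ≤ ε / 2 * Real.exp (-((n : ℝ) + 1) * F n m) := by positivity
      have h5 : g m * Real.exp (-((n : ℝ) + 1) * F n m) =
          Real.exp (-n * F n m) * (g m * Real.exp (-F n m)) := by rw [h1]; ring
      linarith
  have hnum0 : 0 ≤ ∫ m, g m * Real.exp (-((n : ℝ) + 1) * F n m) ∂μ :=
    integral_nonneg fun m => mul_nonneg (hgnn m) (Real.exp_pos _).le
  rw [dist_zero_right, Real.norm_of_nonneg (div_nonneg hnum0 hZ0.le), div_lt_iff₀ hZ0]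
  refine hnum.trans_lt ?_
  have h6 : Real.exp (-n * (F₀ + c)) * ∫ m, B m ∂μ =
      ((∫ m, B m ∂μ) / v * Real.exp (F₀ + c / 2) * Real.exp (-(c / 2)) ^ n) *
        (v * Real.exp (-((n : ℝ) + 1) * (F₀ + c / 2))) := by
    have h7 : Real.exp (-n * (F₀ + c)) = Real.exp (F₀ + c / 2) * Real.exp (-(c / 2)) ^ n *
        Real.exp (-((n : ℝ) + 1) * (F₀ + c / 2)) := by
      rw [← Real.exp_nat_mul, ← Real.exp_add, ← Real.exp_add]; congr 1; ring
    rw [h7]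
    field_simp
  have h8 : Real.exp (-n * (F₀ + c)) * ∫ m, B m ∂μ ≤
      ((∫ m, B m ∂μ) / v * Real.exp (F₀ + c / 2) * Real.exp (-(c / 2)) ^ n) * Z := by
    rw [h6]
    exact mul_le_mul_of_nonneg_left hZlow (by positivity)
  have h9 := mul_lt_mul_of_pos_right hn3 hZ0
  linarith

/-! ### Convergence of the empirical rate functions -/

theorem integral_conditioningEmpirical {N : ℕ} (x : Fin N → Circle) {f : Circle → ℝ}
    (hf : Continuous f) :
    ∫ η, f η ∂(conditioningEmpirical x : Measure Circle) = ((N : ℝ) + 1)⁻¹ * ∑ i, f (x i) := by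
  rw [conditioningEmpirical, FiniteMeasure.toMeasure_smul, FiniteMeasure.toMeasure_sum,
    integral_smul_nnreal_measure,
    integral_finsetSum_measure fun i _ => integrable_of_continuous_compact hf]
  have hdirac : ∀ i, ∫ η, f η ∂(diracProba (x i) : Measure Circle) = f (x i) :=
    fun i => integral_dirac _ _
  simp [hdirac, NNReal.smul_def]

theorem tendsto_empiricalRate {β : ℝ} (h : ℂ) (t : ℝ≥0) {lam : ProbabilityMeasure Circle}
    {x : (N : ℕ) → Fin N → Circle}
    (hx : Tendsto (fun N => conditioningEmpirical (x N)) atTop (𝓝 lam.toFiniteMeasure)) (m : ℂ) :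
    Tendsto (fun N => empiricalRate β h t (x N) m) atTop (𝓝 (rateFunction β h t lam m)) := by
  have hc : Continuous fun η => Real.log (siteWeight β h t m η) :=
    (continuous_siteWeight β h t m).log fun η => (siteWeight_pos β h t m η).ne'
  have h1 := FiniteMeasure.tendsto_iff_forall_integral_tendsto.mp hx
    (BoundedContinuousFunction.mkOfCompact ⟨_, hc⟩)
  simp only [BoundedContinuousFunction.mkOfCompact_apply, ContinuousMap.coe_mk] at h1
  simp_rw [integral_conditioningEmpirical _ hc] at h1
  exact h1.const_sub _

theorem inv_succ_mul_abs_sum_le {N : ℕ} {f : Fin N → ℝ} {C : ℝ} (hC : 0 ≤ C)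
    (hf : ∀ i, |f i| ≤ C) : |((N : ℝ) + 1)⁻¹ * ∑ i, f i| ≤ C := by
  have hN : (0 : ℝ) < N + 1 := by positivity
  rw [abs_mul, abs_of_pos (inv_pos.mpr hN), inv_mul_le_iff₀ hN]
  refine (Finset.abs_sum_le_sum_abs _ _).trans ((Finset.sum_le_sum fun i _ => hf i).trans ?_)
  rw [Finset.sum_const, Finset.card_univ, Fintype.card_fin, nsmul_eq_mul]
  linarith

theorem le_empiricalRate {β : ℝ} (hβ : 0 ≤ β) (h : ℂ) (t : ℝ≥0) {N : ℕ} (x : Fin N → Circle)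
    (m : ℂ) : β * ‖m‖ ^ 2 / 2 - β * (‖m‖ + ‖h‖) ≤ empiricalRate β h t x m := by
  have := (le_abs_self _).trans (inv_succ_mul_abs_sum_le (by positivity)
    fun i => abs_log_siteWeight_le hβ h t m (x i))
  rw [empiricalRate]
  linarith

theorem continuous_empiricalRate {β : ℝ} (hβ : 0 ≤ β) (h : ℂ) (t : ℝ≥0) {N : ℕ}
    (x : Fin N → Circle) : Continuous (empiricalRate β h t x) := by
  unfold empiricalRate
  have := fun i => continuous_log_siteWeight_left hβ h t (x i)
  fun_prop

theorem eventually_forall_abs_empiricalRate_sub_lt {β : ℝ} (hβ : 0 ≤ β) (h : ℂ) (t : ℝ≥0)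
    {lam : ProbabilityMeasure Circle} {x : (N : ℕ) → Fin N → Circle}
    (hx : Tendsto (fun N => conditioningEmpirical (x N)) atTop (𝓝 lam.toFiniteMeasure))
    {S : Set ℂ} (hS : IsCompact S) {ε : ℝ} (hε : 0 < ε) :
    ∀ᶠ N in atTop, ∀ m ∈ S, |empiricalRate β h t (x N) m - rateFunction β h t lam m| < ε := by
  -- The quadratic part cancels in the difference; what remains is `β`-Lipschitz in `m`.
  have hlip : ∀ (N : ℕ) (m m' : ℂ),
      |(empiricalRate β h t (x N) m - β * ‖m‖ ^ 2 / 2) -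
        (empiricalRate β h t (x N) m' - β * ‖m'‖ ^ 2 / 2)| ≤ β * dist m m' := by
    intro N m m'
    have := inv_succ_mul_abs_sum_le (by positivity : 0 ≤ β * ‖m' - m‖)
      fun i => abs_log_siteWeight_sub_le hβ h t m' m (x N i)
    rw [Finset.sum_sub_distrib, mul_sub] at this
    rw [dist_comm, dist_eq_norm]
    refine (congrArg abs ?_).trans_le this
    rw [empiricalRate, empiricalRate]
    ring
  have := eventually_forall_abs_sub_lt_of_lipschitz hlip
    (fun m => (tendsto_empiricalRate h t hx m).sub_const _) hS hε
  simpa only [sub_sub_sub_cancel_right] using this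

theorem integrable_log_siteWeight (β : ℝ) (h : ℂ) (t : ℝ≥0) (lam : ProbabilityMeasure Circle)
    (m : ℂ) : Integrable (fun η => Real.log (siteWeight β h t m η)) (lam : Measure Circle) :=
  integrable_of_continuous_compact
    ((continuous_siteWeight β h t m).log fun η => (siteWeight_pos β h t m η).ne')

theorem abs_integral_log_siteWeight_sub_le {β : ℝ} (hβ : 0 ≤ β) (h : ℂ) (t : ℝ≥0)
    (lam : ProbabilityMeasure Circle) (m m' : ℂ) :
    |∫ η, Real.log (siteWeight β h t m η) ∂(lam : Measure Circle) -
      ∫ η, Real.log (siteWeight β h t m' η) ∂(lam : Measure Circle)| ≤ β * ‖m - m'‖ := by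
  rw [← integral_sub (integrable_log_siteWeight β h t lam m)
    (integrable_log_siteWeight β h t lam m'), ← Real.norm_eq_abs]
  refine (norm_integral_le_of_norm_le_const (Eventually.of_forall fun η =>
    abs_log_siteWeight_sub_le hβ h t m m' η)).trans_eq ?_
  simp

theorem continuous_rateFunction {β : ℝ} (hβ : 0 ≤ β) (h : ℂ) (t : ℝ≥0)
    (lam : ProbabilityMeasure Circle) : Continuous (rateFunction β h t lam) := by
  have h1 : Continuous fun m => ∫ η, Real.log (siteWeight β h t m η) ∂(lam : Measure Circle) := by
    refine (LipschitzWith.of_dist_le_mul (K := ⟨β, hβ⟩) fun m m' => ?_).continuous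
    rw [Real.dist_eq, dist_eq_norm]
    exact abs_integral_log_siteWeight_sub_le hβ h t lam m m'
  exact ((continuous_const.mul (continuous_norm.pow 2)).div_const 2).sub h1

/-- A unique minimizer in the closed unit disk is the unique minimizer in the plane: radially
projecting a point of norm `r > 1` to the circle lowers the rate by at least `β (r - 1)² / 2`. -/
theorem IsUniqueMinimizer.lt {β : ℝ} (hβ : 0 < β) {h : ℂ} {t : ℝ≥0}
    {lam : ProbabilityMeasure Circle} {m : ℂ} (hm : IsUniqueMinimizer β h t lam m) {m' : ℂ}
    (hne : m' ≠ m) : rateFunction β h t lam m < rateFunction β h t lam m' := by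
  rcases le_or_gt ‖m'‖ 1 with h1 | h1
  · exact hm.2 m' (by simpa using h1) hne
  · have hr : ‖m'‖ ≠ 0 := by linarith
    set p : ℂ := ‖m'‖⁻¹ • m' with hp
    have hpn : ‖p‖ = 1 := by rw [hp, norm_smul, norm_inv, norm_norm, inv_mul_cancel₀ hr]
    have hdist : ‖m' - p‖ = ‖m'‖ - 1 := by
      have h2 : m' - p = (1 - ‖m'‖⁻¹) • m' := by rw [hp, sub_smul, one_smul]
      rw [h2, norm_smul, Real.norm_of_nonneg (sub_nonneg.mpr (inv_le_one_of_one_le₀ h1.le)),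
        sub_mul, inv_mul_cancel₀ hr, one_mul]
    have h3 : rateFunction β h t lam m ≤ rateFunction β h t lam p := by
      rcases eq_or_ne p m with h4 | h4
      · rw [h4]
      · exact (hm.2 p (by simp [hpn]) h4).le
    have h5 := (le_abs_self _).trans (abs_integral_log_siteWeight_sub_le hβ.le h t lam m' p)
    rw [hdist] at h5
    have h6 : 0 < β * (‖m'‖ - 1) ^ 2 := by
      have : ‖m'‖ - 1 ≠ 0 := by linarith
      positivity
    refine h3.trans_lt ?_
    change β * ‖p‖ ^ 2 / 2 - ∫ η, Real.log (siteWeight β h t p η) ∂(lam : Measure Circle) <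
      β * ‖m'‖ ^ 2 / 2 - ∫ η, Real.log (siteWeight β h t m' η) ∂(lam : Measure Circle)
    rw [hpn]
    linarith

/-- For `β = 0` the rate function vanishes identically, so a unique minimizer forces `β > 0`. -/
theorem IsUniqueMinimizer.beta_ne_zero {β : ℝ} {h : ℂ} {t : ℝ≥0}
    {lam : ProbabilityMeasure Circle} {m : ℂ} (hm : IsUniqueMinimizer β h t lam m) : β ≠ 0 := by
  rintro rfl
  obtain ⟨m', hm', hne⟩ : ∃ m' ∈ Metric.closedBall (0 : ℂ) 1, m' ≠ m := by
    by_cases h0 : m = 0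
    · exact ⟨1, by simp, by simp [h0]⟩
    · exact ⟨0, by simp, Ne.symm h0⟩
  have := hm.2 m' hm' hne
  simp [rateFunction] at this

/-- Away from the minimizer of `F`, the empirical rates are eventually bounded away from the minimum:
on compact sets by uniform convergence, near infinity by the common quadratic lower bound. -/
theorem exists_forall_eventually_add_le_empiricalRate {β : ℝ} (hβ : 0 < β) {h : ℂ} {t : ℝ≥0}
    {lam : ProbabilityMeasure Circle} {m : ℂ} (hm : IsUniqueMinimizer β h t lam m)
    {x : (N : ℕ) → Fin N → Circle}
    (hx : Tendsto (fun N => conditioningEmpirical (x N)) atTop (𝓝 lam.toFiniteMeasure))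
    {δ : ℝ} (hδ : 0 < δ) :
    ∃ c > 0, ∀ᶠ N in atTop, ∀ m' ∉ Metric.ball m δ,
      rateFunction β h t lam m + c ≤ empiricalRate β h t (x N) m' := by
  set F₀ := rateFunction β h t lam m with hF₀
  -- Outside the disk of radius `R` the quadratic lower bound of the rates exceeds `F₀ + 1`.
  set R := 4 + ‖h‖ + (|F₀| + 1) / β with hR
  have hS : IsCompact (Metric.closedBall (0 : ℂ) R \ Metric.ball m δ) :=
    (isCompact_closedBall _ _).diff Metric.isOpen_ball
  obtain ⟨c, hc, hc1, hcS⟩ : ∃ c : ℝ, 0 < c ∧ c ≤ 1 ∧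
      ∀ m' ∈ Metric.closedBall (0 : ℂ) R \ Metric.ball m δ,
        F₀ + 2 * c ≤ rateFunction β h t lam m' := by
    rcases (Metric.closedBall (0 : ℂ) R \ Metric.ball m δ).eq_empty_or_nonempty with he | hne
    · exact ⟨1, one_pos, le_rfl, by simp [he]⟩
    · obtain ⟨m₁, hm₁, hmin⟩ := hS.exists_isMinOn hne
        (continuous_rateFunction hβ.le h t lam).continuousOn
      have hlt : F₀ < rateFunction β h t lam m₁ := hm.lt hβ fun heq =>
        hm₁.2 (heq ▸ Metric.mem_ball_self hδ)
      refine ⟨min 1 ((rateFunction β h t lam m₁ - F₀) / 2), lt_min one_pos (by linarith),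
        min_le_left _ _, fun m' hm' => ?_⟩
      have h1 := min_le_right 1 ((rateFunction β h t lam m₁ - F₀) / 2)
      have h2 : rateFunction β h t lam m₁ ≤ rateFunction β h t lam m' := hmin hm'
      linarith
  refine ⟨c, hc, ?_⟩
  filter_upwards [eventually_forall_abs_empiricalRate_sub_lt hβ.le h t hx hS hc] with N hN m' hm'
  by_cases hmR : m' ∈ Metric.closedBall (0 : ℂ) R
  · have h1 := (abs_lt.mp (hN m' ⟨hmR, hm'⟩)).1
    have h2 := hcS m' ⟨hmR, hm'⟩
    linarith
  · rw [mem_closedBall_zero_iff, not_le] at hmR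
    have h1 := le_empiricalRate hβ.le h t (x N) m'
    have h0 : 0 ≤ (|F₀| + 1) / β := by positivity
    have hr4 : 4 ≤ ‖m'‖ := by linarith [norm_nonneg h]
    have h2 : β * ((|F₀| + 1) / β) ≤ β * (‖m'‖ - ‖h‖) :=
      mul_le_mul_of_nonneg_left (by linarith) hβ.le
    rw [mul_div_cancel₀ _ hβ.ne'] at h2
    have h3 : 0 ≤ β * (‖m'‖ * (‖m'‖ - 4)) := by
      have := sub_nonneg.mpr hr4
      positivity
    have h4 := le_abs_self F₀
    linarith

theorem integrable_mul_exp_empiricalRate {β : ℝ} (hβ : 0 < β) (h : ℂ) (t : ℝ≥0) {N : ℕ}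
    (x : Fin N → Circle) {f : ℂ → ℝ} (hf : Continuous f) {C b : ℝ}
    (hfb : ∀ m, |f m| ≤ Real.exp (C + b * ‖m‖)) :
    Integrable fun m => f m * Real.exp (-((N : ℝ) + 1) * empiricalRate β h t x m) := by
  have hcont := continuous_empiricalRate hβ.le h t x
  refine ((integrable_exp_neg_mul_sq_norm_add (a := (N + 1) * β / 2) (by positivity)
    (b + (N + 1) * β)).const_mul (Real.exp (C + (N + 1) * β * ‖h‖))).mono'
    (Continuous.aestronglyMeasurable (by fun_prop)) (Eventually.of_forall fun m => ?_)
  rw [norm_mul, Real.norm_of_nonneg (Real.exp_pos _).le, Real.norm_eq_abs]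
  refine (mul_le_mul_of_nonneg_right (hfb m) (Real.exp_pos _).le).trans ?_
  rw [← Real.exp_add, ← Real.exp_add, Real.exp_le_exp]
  have := mul_le_mul_of_nonneg_left (le_empiricalRate hβ.le h t x m)
    (show (0 : ℝ) ≤ N + 1 by positivity)
  linarith

/-- The bound of `abs_siteWeight_sub_le` on the oscillation of the single-site weights. -/
def oscillation (β : ℝ) (h m₀ m : ℂ) : ℝ :=
  Real.exp (β * (‖m₀‖ + ‖h‖)) * (Real.exp (β * ‖m - m₀‖) - 1)

theorem continuous_oscillation (β : ℝ) (h m₀ : ℂ) : Continuous (oscillation β h m₀) := by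
  unfold oscillation
  fun_prop

theorem oscillation_nonneg {β : ℝ} (hβ : 0 ≤ β) (h m₀ m : ℂ) : 0 ≤ oscillation β h m₀ m :=
  mul_nonneg (Real.exp_pos _).le (sub_nonneg.mpr (Real.one_le_exp (by positivity)))

theorem oscillation_le {β : ℝ} (hβ : 0 ≤ β) (h m₀ m : ℂ) :
    oscillation β h m₀ m ≤ Real.exp (β * (2 * ‖m₀‖ + ‖h‖) + β * ‖m‖) := by
  have h1 : Real.exp (β * ‖m - m₀‖) - 1 ≤ Real.exp (β * (‖m‖ + ‖m₀‖)) :=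
    (sub_le_self _ zero_le_one).trans
      (Real.exp_le_exp.mpr (mul_le_mul_of_nonneg_left (norm_sub_le _ _) hβ))
  refine (mul_le_mul_of_nonneg_left h1 (Real.exp_pos _).le).trans_eq ?_
  rw [← Real.exp_add]
  congr 1
  ring

theorem integrable_oscillation {β : ℝ} (hβ : 0 < β) (h : ℂ) (t : ℝ≥0) {N : ℕ}
    (x : Fin N → Circle) (m₀ : ℂ) : Integrable fun m =>
      oscillation β h m₀ m * Real.exp (-((N : ℝ) + 1) * empiricalRate β h t x m) :=
  integrable_mul_exp_empiricalRate hβ h t x (continuous_oscillation β h m₀) fun m =>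
    (abs_of_nonneg (oscillation_nonneg hβ.le h m₀ m)).trans_le (oscillation_le hβ.le h m₀ m)

theorem integrable_exp_empiricalRate {β : ℝ} (hβ : 0 < β) (h : ℂ) (t : ℝ≥0) {N : ℕ}
    (x : Fin N → Circle) :
    Integrable fun m => Real.exp (-((N : ℝ) + 1) * empiricalRate β h t x m) := by
  have := integrable_mul_exp_empiricalRate hβ h t x (continuous_const (y := (1 : ℝ)))
    (C := 0) (b := 0) (by simp)
  simpa using this

/-- The oscillation of the single-site weights around the minimizer, averaged over the Laplace
measure `∝ e^{-(N+1) F_N(m)} dm`. -/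
def meanOscillation (β : ℝ) (h : ℂ) (t : ℝ≥0) {N : ℕ} (x : Fin N → Circle) (m₀ : ℂ) : ℝ :=
  (∫ m, oscillation β h m₀ m * Real.exp (-((N : ℝ) + 1) * empiricalRate β h t x m)) /
    ∫ m, Real.exp (-((N : ℝ) + 1) * empiricalRate β h t x m)

theorem tendsto_meanOscillation {β : ℝ} (hβ : 0 < β) {h : ℂ} {t : ℝ≥0}
    {lam : ProbabilityMeasure Circle} {m : ℂ} (hm : IsUniqueMinimizer β h t lam m)
    {x : (N : ℕ) → Fin N → Circle}
    (hx : Tendsto (fun N => conditioningEmpirical (x N)) atTop (𝓝 lam.toFiniteMeasure)) :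
    Tendsto (fun N => meanOscillation β h t (x N) m) atTop (𝓝 0) := by
  refine tendsto_laplace_zero (F := fun N => empiricalRate β h t (x N))
    (F₀ := rateFunction β h t lam m)
    (B := fun m' => Real.exp (β * (2 * ‖m‖ + ‖h‖) + β * ‖h‖) *
      Real.exp (-(β / 2) * ‖m'‖ ^ 2 + 2 * β * ‖m'‖))
    (continuous_oscillation β h m).continuousAt (by simp [oscillation])
    (oscillation_nonneg hβ.le h m) (fun ε hε => ?_)
    (fun δ hδ => exists_forall_eventually_add_le_empiricalRate hβ hm hx hδ)
    ((integrable_exp_neg_mul_sq_norm_add (half_pos hβ) _).const_mul _) (fun N m' => ?_)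
    (fun N => integrable_exp_empiricalRate hβ h t (x N))
    (fun N => integrable_oscillation hβ h t (x N) m)
  · obtain ⟨δ, hδ, hcont⟩ := Metric.continuousAt_iff.mp
      (continuous_rateFunction hβ.le h t lam).continuousAt (ε / 2) (half_pos hε)
    refine ⟨δ, hδ, ?_⟩
    filter_upwards [eventually_forall_abs_empiricalRate_sub_lt hβ.le h t hx
      (isCompact_closedBall m δ) (half_pos hε)] with N hN m' hm'
    have h1 := hcont hm'
    rw [Real.dist_eq] at h1
    linarith [(abs_lt.mp h1).2, (abs_lt.mp (hN m' (Metric.ball_subset_closedBall hm'))).2]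
  · refine (mul_le_mul_of_nonneg_right (oscillation_le hβ.le h m m') (Real.exp_pos _).le).trans ?_
    rw [← Real.exp_add, ← Real.exp_add, Real.exp_le_exp]
    linarith [le_empiricalRate hβ.le h t (x N) m']

/-! ### Convergence of the conditional distributions -/

/-- The normalized density at the first site differs from the tilted weight at `m₀` by at most the
mean oscillation, uniformly in the spin `a`. -/
theorem abs_evolvedDensity_sub_siteWeight_le {β : ℝ} (hβ : 0 < β) (h : ℂ) (t : ℝ≥0) {N : ℕ}
    (x : Fin N → Circle) (m₀ : ℂ) (a : Circle) :
    |gaussianMass β (N + 1) / (∫ m, Real.exp (-((N : ℝ) + 1) * empiricalRate β h t x m)) *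
      evolvedDensity β h t (Fin.cons a x : Fin (N + 1) → Circle) - siteWeight β h t m₀ a| ≤
      meanOscillation β h t x m₀ := by
  have hcont : Continuous fun m => siteWeight β h t m a := by
    have := Real.continuous_exp.comp (continuous_log_siteWeight_left hβ.le h t a)
    refine this.congr fun m => Real.exp_log (siteWeight_pos β h t m a)
  have hZ := integrable_exp_empiricalRate hβ h t x
  have hφ : Integrable fun m => siteWeight β h t m a *
      Real.exp (-((N : ℝ) + 1) * empiricalRate β h t x m) :=
    integrable_mul_exp_empiricalRate hβ h t x hcont (C := β * ‖h‖) (b := β) fun m => by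
      rw [abs_of_pos (siteWeight_pos β h t m a)]
      exact (siteWeight_le hβ.le h t m a).trans_eq (by congr 1; ring)
  have hZ0 : 0 < ∫ m, Real.exp (-((N : ℝ) + 1) * empiricalRate β h t x m) := integral_exp_pos hZ
  rw [div_mul_eq_mul_div, gaussianMass_mul_evolvedDensity hβ, meanOscillation,
    div_sub' hZ0.ne', abs_div, abs_of_pos hZ0, div_le_div_iff_of_pos_right hZ0,
    mul_comm _ (siteWeight β h t m₀ a), ← integral_const_mul, ← integral_sub hφ (hZ.const_mul _),
    ← Real.norm_eq_abs]
  refine norm_integral_le_of_norm_le (integrable_oscillation hβ h t x m₀)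
    (Eventually.of_forall fun m => ?_)
  rw [← sub_mul, norm_mul, Real.norm_of_nonneg (Real.exp_pos _).le, Real.norm_eq_abs]
  exact mul_le_mul_of_nonneg_right (abs_siteWeight_sub_le hβ.le h t m m₀ a) (Real.exp_pos _).le

/-- By reversibility, the single-site weight is the density of the heat flow applied to the tilted
equidistribution. -/
theorem setIntegral_siteWeight (β : ℝ) (h : ℂ) (t : ℝ≥0) (m : ℂ) {A : Set Circle}
    (hA : MeasurableSet A) : ENNReal.ofReal (∫ a in A, siteWeight β h t m a ∂unif) =
      (unif.withDensity (tilt β h m)).bind (heatKernel t) A := by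
  have ht : Measurable (tilt β h m) := (continuous_tilt β h m).measurable
  rw [Measure.bind_apply hA (heatKernel t).measurable.aemeasurable,
    lintegral_withDensity_eq_lintegral_mul _ ht ((heatKernel t).measurable_coe hA),
    ofReal_integral_eq_lintegral_ofReal
      (integrable_of_continuous_compact (continuous_siteWeight β h t m)).integrableOn
      (Eventually.of_forall fun a => (siteWeight_pos β h t m a).le)]
  have h1 := lintegral_heatKernel_symm t ht (measurable_one.indicator hA)
  simp only [lintegral_indicator_one hA] at h1
  refine Eq.trans ?_ h1.symm
  rw [← lintegral_indicator hA]
  have h2 : ∀ a, ENNReal.ofReal (siteWeight β h t m a) = ∫⁻ σ, tilt β h m σ ∂(heatKernel t a) :=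
    fun a => ofReal_integral_eq_lintegral_ofReal
      (integrable_of_continuous_compact (continuous_exp_inner β (m + h)))
      (Eventually.of_forall fun σ => (Real.exp_pos _).le)
  refine lintegral_congr fun a => ?_
  by_cases ha : a ∈ A <;> simp [ha, h2]

theorem integral_siteWeight_pos (β : ℝ) (h : ℂ) (t : ℝ≥0) (m : ℂ) :
    0 < ∫ a, siteWeight β h t m a ∂unif := by
  rw [integral_pos_iff_support_of_nonneg (fun a => (siteWeight_pos β h t m a).le)
    (integrable_of_continuous_compact (continuous_siteWeight β h t m))]
  have : Function.support (siteWeight β h t m) = Set.univ :=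
    Set.eq_univ_of_forall fun a => (siteWeight_pos β h t m a).ne'
  simp [this]

theorem limitKernel_apply (β : ℝ) (h : ℂ) (t : ℝ≥0) (m : ℂ) {A : Set Circle}
    (hA : MeasurableSet A) : (limitKernel β h t m : Measure Circle) A = ENNReal.ofReal
      ((∫ a in A, siteWeight β h t m a ∂unif) / ∫ a, siteWeight β h t m a ∂unif) := by
  have hmass : ENNReal.ofReal (∫ a, siteWeight β h t m a ∂unif) = ∫⁻ σ, tilt β h m σ ∂unif := by
    have := setIntegral_siteWeight β h t m MeasurableSet.univ
    rw [Measure.restrict_univ, Measure.bind_apply MeasurableSet.univ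
      (heatKernel t).measurable.aemeasurable] at this
    simpa using this
  change ((∫⁻ σ, tilt β h m σ ∂unif)⁻¹ •
    (unif.withDensity (tilt β h m)).bind (heatKernel t)) A = _
  rw [Measure.smul_apply, ← hmass, ← setIntegral_siteWeight β h t m hA, smul_eq_mul,
    ENNReal.ofReal_div_of_pos (integral_siteWeight_pos β h t m), mul_comm, ENNReal.div_eq_inv_mul,
    mul_comm]

/-- The continuous version of the conditional distribution of the evolved model. -/
def evolvedKernel (β : ℝ) (h : ℂ) (t : ℝ≥0) (N : ℕ) :
    (Fin N → Circle) → ProbabilityMeasure Circle :=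
  conditionalKernel (continuous_evolvedDensity β h t (N + 1)) (evolvedDensity_pos β h t)

theorem tendsto_evolvedKernel_apply {β : ℝ} (hβ : 0 < β) {h : ℂ} {t : ℝ≥0}
    {lam : ProbabilityMeasure Circle} {m : ℂ} (hm : IsUniqueMinimizer β h t lam m)
    {x : (N : ℕ) → Fin N → Circle}
    (hx : Tendsto (fun N => conditioningEmpirical (x N)) atTop (𝓝 lam.toFiniteMeasure))
    {A : Set Circle} (hA : MeasurableSet A) :
    Tendsto (fun N => (evolvedKernel β h t N (x N) : Measure Circle) A) atTop
      (𝓝 ((limitKernel β h t m : Measure Circle) A)) := by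
  set s : ℕ → ℝ := fun N => gaussianMass β (N + 1) /
    ∫ m', Real.exp (-((N : ℝ) + 1) * empiricalRate β h t (x N) m') with hs
  have hs0 : ∀ N, s N ≠ 0 := fun N => (div_pos (gaussianMass_pos hβ N.succ_pos)
    (integral_exp_pos (integrable_exp_empiricalRate hβ h t (x N)))).ne'
  have hφ := integrable_of_continuous_compact (μ := unif) (continuous_siteWeight β h t m)
  have hD := fun N : ℕ => integrable_cons (continuous_evolvedDensity β h t (N + 1)) (x N)
  have key : ∀ S : Set Circle, Tendsto (fun N => s N * ∫ a in S,
      evolvedDensity β h t (Fin.cons a (x N) : Fin (N + 1) → Circle) ∂unif) atTop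
      (𝓝 (∫ a in S, siteWeight β h t m a ∂unif)) := by
    intro S
    rw [tendsto_iff_norm_sub_tendsto_zero]
    refine squeeze_zero (fun N => norm_nonneg _) (fun N => ?_) (tendsto_meanOscillation hβ hm hx)
    rw [← integral_const_mul, ← integral_sub ((hD N).const_mul _).integrableOn hφ.integrableOn]
    have hbound := fun a => abs_evolvedDensity_sub_siteWeight_le hβ h t (x N) m a
    refine (norm_integral_le_of_norm_le_const (Eventually.of_forall hbound)).trans ?_
    exact mul_le_of_le_one_right ((abs_nonneg _).trans (hbound 1)) (by simp)
  have hlim := (key A).div (key Set.univ) (by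
    simpa using (integral_siteWeight_pos β h t m).ne')
  rw [limitKernel_apply β h t m hA]
  refine ENNReal.tendsto_ofReal ?_ |>.congr fun N => (conditionalMeasure_apply
    (continuous_evolvedDensity β h t (N + 1)) (evolvedDensity_pos β h t) (x N) hA).symm
  simp only [Measure.restrict_univ] at hlim
  refine hlim.congr fun N => ?_
  simp only [Pi.div_apply]
  rw [mul_div_mul_left _ _ (hs0 N)]

end

end MeanFieldRotator

theorem mainTheorem5 (β : ℝ) (hβ : 0 ≤ β) (h : ℂ) (t : ℝ≥0) :
    ∃ κ : (N : ℕ) → (Fin N → Circle) → ProbabilityMeasure Circle,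
      (∀ N, MeanFieldRotator.IsContinuousConditional
          (MeanFieldRotator.evolvedMeasure β h t (N + 1)) (κ N) ∧
        ∀ κ' : (Fin N → Circle) → ProbabilityMeasure Circle,
          MeanFieldRotator.IsContinuousConditional
            (MeanFieldRotator.evolvedMeasure β h t (N + 1)) κ' → κ' = κ N) ∧
      ∀ (lam : ProbabilityMeasure Circle) (m : ℂ),
        MeanFieldRotator.IsUniqueMinimizer β h t lam m →
        ∀ x : (N : ℕ) → Fin N → Circle,
          Tendsto (fun N => MeanFieldRotator.conditioningEmpirical (x N)) atTop
            (𝓝 lam.toFiniteMeasure) →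
          Tendsto (fun N => κ N (x N)) atTop
              (𝓝 (MeanFieldRotator.limitKernel β h t m)) ∧
            ∀ A : Set Circle, MeasurableSet A →
              Tendsto (fun N => (κ N (x N) : Measure Circle) A) atTop
                (𝓝 ((MeanFieldRotator.limitKernel β h t m : Measure Circle) A)) := by
  refine ⟨MeanFieldRotator.evolvedKernel β h t, fun N => ?_, fun lam m hm x hx => ?_⟩
  · rw [MeanFieldRotator.evolvedMeasure_eq_withDensity]
    have hκ := MeanFieldRotator.isContinuousConditional_conditionalKernel
      (MeanFieldRotator.continuous_evolvedDensity β h t (N + 1))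
      (MeanFieldRotator.evolvedDensity_pos β h t)
      (∫⁻ σ, MeanFieldRotator.gibbsWeight β h σ
        ∂(Measure.pi fun _ : Fin (N + 1) => MeanFieldRotator.unif))⁻¹
    exact ⟨hκ, fun κ' hκ' => MeanFieldRotator.IsContinuousConditional.eq_of_density
      (MeanFieldRotator.continuous_evolvedDensity β h t (N + 1))
      (MeanFieldRotator.evolvedDensity_pos β h t)
      (ENNReal.inv_ne_zero.mpr (MeanFieldRotator.lintegral_gibbsWeight_ne_top β h (N + 1)))
      (ENNReal.inv_ne_top.mpr (MeanFieldRotator.lintegral_gibbsWeight_ne_zero β h (N + 1)))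
      hκ hκ'⟩
  · have hpos : 0 < β := lt_of_le_of_ne hβ hm.beta_ne_zero.symm
    have hset := fun A (hA : MeasurableSet A) =>
      MeanFieldRotator.tendsto_evolvedKernel_apply hpos hm hx hA
    exact ⟨tendsto_of_forall_isOpen_le_liminf' fun G hG =>
      (hset G hG.measurableSet).liminf_eq.ge, hset⟩
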